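/- A computable presentation of a field $\mathcal F$ is an injective coding of its elements by the natural numbers of a computable set for which addition and multiplication are computable on codes. Relative to a presentation, $\mathcal F$ has a splitting algorithm if the set of polynomials in $\mathcal F[X]$ (given by the codes of their coefficients) that are products of two nonconstant polynomials in $\mathcal F[X]$ is computable. A Rabin embedding of a presented field $\mathcal F$ is a computable field embedding $\imath$ of $\mathcal F$ into a computable presentation of an algebraically closed field $\overline{\mathcal F}$ that is algebraic over $\imath(\mathcal F)$. Proposition 4.2. Let $p_0<p_1<\cdots$ be the primes greater than $2$, let $\varnothing'=\{n:\varphi_n(n)\text{ halts}\}$ be the Turing jump of the empty set, and let $\mathcal F=\mathbb Q(2^{1/p_n}:n\in\varnothing')\subseteq\mathbb R$, where $2^{1/p_n}$ is the real $p_n$-th root of $2$. Then $\mathcal F$ is a rigid computable algebraic field of characteristic zero with no splitting algorithm. Precisely: (a) $\mathcal F$ has characteristic zero, is algebraic over $\mathbb Q$, and is not normal over $\mathbb Q$. (b) The identity is the only field automorphism of $\mathcal F$. (c) $\mathcal F$ has a computable presentation with the computable extendability of automorphisms property: for every computable automorphism $\alpha$ of $\mathcal F$ there are a Rabin embedding $\imath:\mathcal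 F\to\overline{\mathcal F}$ and a computable automorphism $\beta$ of $\overline{\mathcal F}$ with $\imath\circ\alpha=\beta\circ\imath$. (d) No computable presentation of $\mathcal F$ has a splitting algorithm. (e) For every computable presentation of $\mathcal F$, every Rabin embedding $\imath:\mathcal F\to\overline{\mathcal F}$ and every computable automorphism $\alpha$ of $\mathcal F$, there is a computable automorphism $\beta$ of $\overline{\mathcal F}$ with $\imath\circ\alpha=\beta\circ\imath$. In particular, for a computable algebraic field and a Rabin embedding $\imath$ of it, the property that every computable automorphism extends along $\imath$ to a computable automorphism of the algebraic closure does not imply the existence of a splitting algorithm if the field is not assumed to be normal over its prime field. -/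

import Mathlib

open Polynomial

/-- A computable presentation of a field `K`: the elements of `K` are coded without repetition by
the natural numbers of a computable set, and addition and multiplication are computable on codes.
(Zero, one, negation and inversion are then computable as well, by searching the domain.) -/
structure ComputablePresentation (K : Type*) [Field K] where
  /-- The number that codes an element. -/
  code : K → ℕ
  code_injective : Function.Injective code
  computable_domain : ComputablePred fun n : ℕ => n ∈ Set.range code
  computable_add : ∃ f : ℕ → ℕ → ℕ, Computable₂ f ∧ ∀ x y, f (code x) (code y) = code (x + y)
  computable_mul : ∃ f : ℕ → ℕ → ℕ, Computable₂ f ∧ ∀ x y, f (code x) (code y) = code (x * y)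

/-- The polynomial `c₀ + c₁ X + c₂ X² + ⋯` with the given list `[c₀, c₁, c₂, …]` of coefficients. -/
noncomputable def polyOfCoeffs {K : Type*} [Field K] (c : List K) : K[X] :=
  c.foldr (fun a p => C a + X * p) 0

/-- A polynomial over a field is reducible if it is a product of two nonconstant polynomials. -/
def IsReduciblePoly {K : Type*} [Field K] (p : K[X]) : Prop :=
  ∃ g h : K[X], 0 < g.natDegree ∧ 0 < h.natDegree ∧ p = g * h

namespace ComputablePresentation

/-- The splitting set: all reducible polynomials over `K`, each given by the list of the codes of
its coefficients. -/
def splittingSet {K : Type*} [Field K] (P : ComputablePresentation K) : Set (List ℕ) :=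
  {l | ∃ c : List K, l = c.map P.code ∧ IsReduciblePoly (polyOfCoeffs c)}

/-- The presented field has a splitting algorithm if its splitting set is computable. -/
def HasSplittingAlgorithm {K : Type*} [Field K] (P : ComputablePresentation K) : Prop :=
  ComputablePred fun l : List ℕ => l ∈ P.splittingSet

/-- A map between presented fields is computable if it is induced by a computable function on
codes. -/
def IsComputableMap {K L : Type*} [Field K] [Field L] (P : ComputablePresentation K)
    (Q : ComputablePresentation L) (f : K → L) : Prop :=
  ∃ g : ℕ → ℕ, Computable g ∧ ∀ x, g (P.code x) = Q.code (f x)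

/-- A Rabin embedding: a computable field embedding into a computable presentation of an
algebraically closed field that is algebraic over the image. -/
def IsRabinEmbedding {K E : Type*} [Field K] [Field E] (P : ComputablePresentation K)
    (Q : ComputablePresentation E) (i : K →+* E) : Prop :=
  IsAlgClosed E ∧ P.IsComputableMap Q i ∧ ∀ y : E, ∃ p : K[X], p ≠ 0 ∧ p.eval₂ i y = 0

/-- Every computable automorphism of the presented field `K` extends, along the embedding `i` of
`K` into the presented field `E`, to a computable automorphism of `E`. -/
def AutomorphismsExtendAlong {K E : Type*} [Field K] [Field E] (P : ComputablePresentation K)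
    (Q : ComputablePresentation E) (i : K →+* E) : Prop :=
  ∀ α : K ≃+* K, P.IsComputableMap P α →
    ∃ β : E ≃+* E, Q.IsComputableMap Q β ∧ ∀ x, i (α x) = β (i x)

/-- The computable extendability of automorphisms property: every computable automorphism of `K`
extends to a computable automorphism of the algebraic closure along some Rabin embedding. (A field
with a computable presentation is countable, so `Type` contains all of them up to isomorphism.) -/
def ComputableExtendabilityOfAutomorphisms {K : Type*} [Field K]
    (P : ComputablePresentation K) : Prop :=
  ∀ α : K ≃+* K, P.IsComputableMap P α →
    ∃ (E : Type) (_ : Field E) (Q : ComputablePresentation E) (i : K →+* E),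
      P.IsRabinEmbedding Q i ∧
        ∃ β : E ≃+* E, Q.IsComputableMap Q β ∧ ∀ x, i (α x) = β (i x)

end ComputablePresentation

/-- A field is rigid if the identity is its only automorphism. -/
def IsRigidField (K : Type*) [Field K] : Prop :=
  ∀ σ : K ≃+* K, σ = RingEquiv.refl K

/-- The Turing jump of the empty set: all `n` such that the `n`-th partial computable function
halts on input `n`. -/
def jumpOfEmpty : Set ℕ :=
  {n | ((Denumerable.ofNat Nat.Partrec.Code n).eval n).Dom}

/-- The `n`-th prime greater than two: `3, 5, 7, 11, …` for `n = 0, 1, 2, 3, …`. -/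
noncomputable def oddPrime (n : ℕ) : ℕ :=
  Nat.nth (fun p => p.Prime ∧ 2 < p) n

/-- The real root of `2` whose degree is the `n`-th odd prime. -/
noncomputable def rootOfTwo (n : ℕ) : ℝ :=
  (2 : ℝ) ^ (1 / (oddPrime n : ℝ))

/-- The subfield of `ℝ` generated over `ℚ` by these roots, for `n` in the jump of the empty set. -/
noncomputable def jumpRootField : IntermediateField ℚ ℝ :=
  IntermediateField.adjoin ℚ (rootOfTwo '' jumpOfEmpty)

/-!
The field is real and its generators have odd degree. So each generator is the only root of its
polynomial `X ^ p - 2` in the field, which makes the field rigid (`isRigidField_jumpRootField`) and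
not normal; extending automorphisms is then trivial, since only the identity has to be extended.

The root of degree `p = oddPrime n` lies in the field only for `n` in the jump: the degree of the
field generated by finitely many other roots is prime to `p`
(`coprime_finrank_adjoin_rootOfTwo`). As `X ^ p - 2` is irreducible or has a root, it is reducible
exactly for `n` in the jump, and a splitting algorithm would decide the halting problem
(`not_hasSplittingAlgorithm`).

The remaining point is a computable presentation of the field with a Rabin embedding
(`exists_rabinEmbedding`). A field has a computable presentation as soon as it has a numbering, with
repetitions, for which addition and multiplication are computable and equality is semidecidable
(`EffectiveNumbering.exists_presentation`), because in a field an inequality is witnessed by an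
inverse. This passes to subfields generated by a computable sequence
(`EffectiveNumbering.exists_numbering_of_closure_eq_top`), such as the sequence of the roots with
index in the jump, along some computable enumeration of the jump.

So it is enough to number the algebraic closure of `ℚ` in `ℂ`, and by real and imaginary parts and
differences, to number the positive real algebraic numbers. Each of these is a root, isolated in a
rational interval, of an integer polynomial that is increasing there (`RootCode`), and it can be
approximated by shrinking the interval. For such `x`, `y`, `z` the algebraic numbers `x + y - z` and
`x * y - z` are zero or bounded away from zero by a computable constant, because the norm of a
nonzero algebraic integer is at least one in absolute value (`one_le_norm_mul_pow`). Hence the graphs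
of addition and multiplication are semidecidable (`RootCode.semiDec_add`, `RootCode.semiDec_mul`),
and searching them computes sums and products.
-/

/-! ### Semidecidable predicates -/

/-- A predicate is semidecidable if it is a projection `∃ k, f a k` of a computable test. (This is
the existential form of `REPred`; it is the convenient one for closure under quantifiers and for
search.) -/
def SemiDec {α : Type*} [Primcodable α] (p : α → Prop) : Prop :=
  ∃ f : α → ℕ → Bool, Computable₂ f ∧ ∀ a, p a ↔ ∃ k, f a k = true

namespace SemiDec

variable {α β : Type*} [Primcodable α] [Primcodable β]

theorem of_eq {p q : α → Prop} (hp : SemiDec p) (h : ∀ a, p a ↔ q a) : SemiDec q := by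
  obtain ⟨f, hf, hfp⟩ := hp
  exact ⟨f, hf, fun a => (h a).symm.trans (hfp a)⟩

theorem of_computablePred {p : α → Prop} (hp : ComputablePred p) : SemiDec p := by
  obtain ⟨_, hp⟩ := hp
  exact ⟨fun a _ => decide (p a), (hp.comp Computable.fst).to₂, fun a => by simp⟩

theorem comp {p : β → Prop} (hp : SemiDec p) {g : α → β} (hg : Computable g) :
    SemiDec fun a => p (g a) := by
  obtain ⟨f, hf, hfp⟩ := hp
  exact ⟨fun a k => f (g a) k, hf.comp (hg.comp Computable.fst) Computable.snd, fun a => hfp _⟩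

theorem and {p q : α → Prop} (hp : SemiDec p) (hq : SemiDec q) : SemiDec fun a => p a ∧ q a := by
  obtain ⟨f, hf, hfp⟩ := hp
  obtain ⟨g, hg, hgq⟩ := hq
  have hu1 : Computable fun x : α × ℕ => x.2.unpair.1 :=
    Computable.fst.comp (Computable.unpair.comp Computable.snd)
  have hu2 : Computable fun x : α × ℕ => x.2.unpair.2 :=
    Computable.snd.comp (Computable.unpair.comp Computable.snd)
  refine ⟨fun a k => f a k.unpair.1 && g a k.unpair.2,
    Primrec.and.to_comp.comp (hf.comp Computable.fst hu1) (hg.comp Computable.fst hu2),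
    fun a => ?_⟩
  beta_reduce
  rw [hfp, hgq]
  constructor
  · rintro ⟨⟨k, hk⟩, l, hl⟩
    exact ⟨Nat.pair k l, by simp [hk, hl]⟩
  · rintro ⟨k, hk⟩
    rw [Bool.and_eq_true] at hk
    exact ⟨⟨_, hk.1⟩, _, hk.2⟩

theorem exists_snd {p : α × β → Prop} (hp : SemiDec p) : SemiDec fun a => ∃ b, p (a, b) := by
  obtain ⟨f, hf, hfp⟩ := hp
  have hu1 : Computable fun x : α × ℕ => (Encodable.decode x.2.unpair.1 : Option β) :=
    Computable.decode.comp (Computable.fst.comp (Computable.unpair.comp Computable.snd))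
  have hu2 : Computable fun x : (α × ℕ) × β => x.1.2.unpair.2 :=
    Computable.snd.comp (Computable.unpair.comp (Computable.snd.comp Computable.fst))
  refine ⟨fun a k => Option.casesOn (motive := fun _ => Bool)
      (Encodable.decode k.unpair.1 : Option β) false fun b => f (a, b) k.unpair.2,
    Computable.option_casesOn hu1 (Computable.const false)
      (hf.comp ((Computable.fst.comp Computable.fst).pair Computable.snd) hu2).to₂, fun a => ?_⟩
  constructor
  · rintro ⟨b, hb⟩
    obtain ⟨k, hk⟩ := (hfp _).1 hb
    exact ⟨Nat.pair (Encodable.encode b) k, by simp [hk]⟩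
  · rintro ⟨k, hk⟩
    cases hb : (Encodable.decode k.unpair.1 : Option β) with
    | none => simp [hb] at hk
    | some b => exact ⟨b, (hfp _).2 ⟨_, by simpa [hb] using hk⟩⟩

/-- A semidecidable relation that is total on the left contains the graph of a computable
function. -/
theorem exists_computable {p : α × β → Prop} (hp : SemiDec p) (h : ∀ a, ∃ b, p (a, b)) :
    ∃ f : α → β, Computable f ∧ ∀ a, p (a, f a) := by
  obtain ⟨f, hf, hfp⟩ := hp
  have hu1 : Computable fun x : α × ℕ => (Encodable.decode x.2.unpair.1 : Option β) :=
    Computable.decode.comp (Computable.fst.comp (Computable.unpair.comp Computable.snd))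
  have hu2 : Computable fun x : (α × ℕ) × β => x.1.2.unpair.2 :=
    Computable.snd.comp (Computable.unpair.comp (Computable.snd.comp Computable.fst))
  let g : α → ℕ → Option β := fun a k => (Encodable.decode k.unpair.1 : Option β).bind fun b =>
    bif f (a, b) k.unpair.2 then some b else none
  have hg : Computable₂ g := Computable.option_bind hu1 (Computable.cond
      (hf.comp ((Computable.fst.comp Computable.fst).pair Computable.snd) hu2)
      (Computable.option_some.comp Computable.snd) (Computable.const none)).to₂
  have key : ∀ a b, b ∈ Nat.rfindOpt (g a) → p (a, b) := by
    intro a b hb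
    obtain ⟨k, hk⟩ := Nat.rfindOpt_spec hb
    simp only [g, Option.mem_def, Option.bind_eq_some_iff] at hk
    obtain ⟨b', -, hk⟩ := hk
    cases hfk : f (a, b') k.unpair.2 <;> simp [hfk] at hk
    exact (hfp _).2 ⟨_, hk ▸ hfk⟩
  have hdom : ∀ a, (Nat.rfindOpt (g a)).Dom := by
    intro a
    obtain ⟨b, hb⟩ := h a
    obtain ⟨k, hk⟩ := (hfp _).1 hb
    exact Nat.rfindOpt_dom.2 ⟨Nat.pair (Encodable.encode b) k, b, by simp [g, hk]⟩
  exact ⟨fun a => (Nat.rfindOpt (g a)).get (hdom a),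
    (Partrec.rfindOpt hg).of_eq_tot fun a => Part.get_mem _, fun a => key _ _ (Part.get_mem _)⟩

/-- Post's theorem. -/
theorem computablePred {p : α → Prop} (hp : SemiDec p) (hn : SemiDec fun a => ¬ p a) :
    ComputablePred p := by
  classical
  obtain ⟨f, hf, hfp⟩ := hp
  obtain ⟨g, hg, hgp⟩ := hn
  have hr : SemiDec fun x : α × Bool => if x.2 then p x.1 else ¬ p x.1 := by
    refine ⟨fun x k => bif x.2 then f x.1 k else g x.1 k,
      Computable.cond (Computable.snd.comp Computable.fst)
        (hf.comp (Computable.fst.comp Computable.fst) Computable.snd)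
        (hg.comp (Computable.fst.comp Computable.fst) Computable.snd), ?_⟩
    rintro ⟨a, _ | _⟩
    · simpa using hgp a
    · simpa using hfp a
  obtain ⟨d, hd, hdp⟩ := hr.exists_computable fun a => by
    by_cases h : p a
    · exact ⟨true, by simpa using h⟩
    · exact ⟨false, by simpa using h⟩
  refine ComputablePred.computable_iff.2 ⟨d, hd, ?_⟩
  funext a
  have := hdp a
  cases h : d a <;> simp_all

end SemiDec

/-! ### Presentations from numberings -/

/-- An effective numbering of a field by a type of codes: every element has codes, possibly many,
addition and multiplication are computable on codes, and equality of the coded elements is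
semidecidable. -/
structure EffectiveNumbering (K : Type*) [Field K] (α : Type*) [Primcodable α] where
  /-- The element with the given code. -/
  val : α → K
  surjective : Function.Surjective val
  /-- Addition on codes. -/
  add : α → α → α
  /-- Multiplication on codes. -/
  mul : α → α → α
  computable_add : Computable₂ add
  computable_mul : Computable₂ mul
  val_add : ∀ a b, val (add a b) = val a + val b
  val_mul : ∀ a b, val (mul a b) = val a * val b
  semiDec_eq : SemiDec fun x : α × α => val x.1 = val x.2

namespace EffectiveNumbering

variable {K : Type*} [Field K] {α : Type*} [Primcodable α] (N : EffectiveNumbering K α)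

/-- In a field, `x ≠ y` is witnessed by an inverse of the difference, so that semidecidable
equality is decidable. -/
theorem computablePred_eq : ComputablePred fun x : α × α => N.val x.1 = N.val x.2 := by
  refine N.semiDec_eq.computablePred ?_
  obtain ⟨o, ho⟩ := N.surjective 1
  have h1 : SemiDec fun y : (α × α) × α × α => N.val (N.add y.1.1 y.2.1) = N.val y.1.2 :=
    N.semiDec_eq.comp ((N.computable_add.comp (Computable.fst.comp Computable.fst)
      (Computable.fst.comp Computable.snd)).pair (Computable.snd.comp Computable.fst))
  have h2 : SemiDec fun y : (α × α) × α × α => N.val (N.mul y.2.1 y.2.2) = N.val o :=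
    N.semiDec_eq.comp ((N.computable_mul.comp (Computable.fst.comp Computable.snd)
      (Computable.snd.comp Computable.snd)).pair (Computable.const o))
  refine (h1.and h2).exists_snd.of_eq ?_
  rintro ⟨a, b⟩
  simp only [N.val_add, N.val_mul, ho]
  constructor
  · rintro ⟨⟨c, d⟩, hc, hd⟩ hab
    have : N.val c = 0 := by rw [hab] at hc; simpa using hc
    simp [this] at hd
  · intro hab
    obtain ⟨c, hc⟩ := N.surjective (N.val b - N.val a)
    obtain ⟨d, hd⟩ := N.surjective (N.val b - N.val a)⁻¹
    refine ⟨(c, d), by simp [hc], ?_⟩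
    simp only [hc, hd]
    exact mul_inv_cancel₀ (sub_ne_zero.2 (Ne.symm hab))

/-- An effectively numbered field has a computable presentation, and one can pass computably
between the codes of the numbering and the codes of the presentation: an element is presented by
the least number that denotes it. -/
theorem exists_presentation :
    ∃ (P : ComputablePresentation K) (c : α → ℕ) (d : ℕ → α), Computable c ∧ Computable d ∧
      (∀ a, c a = P.code (N.val a)) ∧ ∀ x, N.val (d (P.code x)) = x := by
  classical
  obtain ⟨a₀, -⟩ := N.surjective 0
  let d : ℕ → α := fun n => (Encodable.decode n : Option α).getD a₀
  have hd : Computable d := Computable.option_getD Computable.decode (Computable.const a₀)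
  have hsurj : ∀ x, ∃ n, N.val (d n) = x := fun x => by
    obtain ⟨a, ha⟩ := N.surjective x
    exact ⟨Encodable.encode a, by simp [d, ha]⟩
  let code : K → ℕ := fun x => Nat.find (hsurj x)
  have hdcode : ∀ x, N.val (d (code x)) = x := fun x => Nat.find_spec (hsurj x)
  have hc : Computable fun a => code (N.val a) :=
    Computable.find (P := fun a n => N.val (d n) = N.val a)
      (ComputablePred.computable_iff.2 (by
        obtain ⟨f, hf, h⟩ := ComputablePred.computable_iff.1 N.computablePred_eq
        refine ⟨fun x => f (d x.2, x.1),
          hf.comp ((hd.comp Computable.snd).pair Computable.fst), ?_⟩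
        funext x
        exact congrFun h (d x.2, x.1)))
      fun a => hsurj (N.val a)
  have hcd : Computable fun n => code (N.val (d n)) := hc.comp hd
  refine ⟨⟨code, fun x y h => by rw [← hdcode x, h, hdcode], ?_,
    ⟨fun m n => code (N.val (N.add (d m) (d n))), ?_, fun x y => ?_⟩,
    ⟨fun m n => code (N.val (N.mul (d m) (d n))), ?_, fun x y => ?_⟩⟩,
    fun a => code (N.val a), d, hc, hd, fun _ => rfl, hdcode⟩
  · refine ⟨Classical.decPred _, ?_⟩
    refine (Primrec.eq (α := ℕ)).decide.to_comp.comp hcd Computable.id |>.of_eq fun n => ?_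
    rw [decide_eq_decide]
    constructor
    · intro h
      exact ⟨_, h⟩
    · rintro ⟨x, rfl⟩
      rw [hdcode]
      rfl
  · exact hc.comp (N.computable_add.comp (hd.comp Computable.fst) (hd.comp Computable.snd))
  · simp only [N.val_add, hdcode]
  · exact hc.comp (N.computable_mul.comp (hd.comp Computable.fst) (hd.comp Computable.snd))
  · simp only [N.val_mul, hdcode]

end EffectiveNumbering

/-! ### Subfields generated by computable sequences -/

namespace EffectiveNumbering

variable {E : Type*} [Field E] {α : Type*} [Primcodable α] (N : EffectiveNumbering E α)

theorem exists_computable_inv :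
    ∃ f : α → α, Computable f ∧ ∀ a, N.val (f a) = (N.val a)⁻¹ := by
  have h1 : SemiDec fun x : α × α => N.val (N.mul (N.mul x.1 x.1) x.2) = N.val x.1 :=
    N.semiDec_eq.comp ((N.computable_mul.comp (N.computable_mul.comp Computable.fst Computable.fst)
      Computable.snd).pair Computable.fst)
  have h2 : SemiDec fun x : α × α => N.val (N.mul (N.mul x.2 x.2) x.1) = N.val x.2 :=
    N.semiDec_eq.comp ((N.computable_mul.comp (N.computable_mul.comp Computable.snd Computable.snd)
      Computable.fst).pair Computable.snd)
  -- The pair of equations `x * x * y = x`, `y * y * x = y` characterizes `y = x⁻¹`, also at `x = 0`.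
  obtain ⟨f, hf, h⟩ := (h1.and h2).exists_computable fun a => by
    obtain ⟨b, hb⟩ := N.surjective (N.val a)⁻¹
    refine ⟨b, ?_, ?_⟩
    · simp only [N.val_mul, hb]
      by_cases h0 : N.val a = 0
      · simp [h0]
      · field_simp
    · simp only [N.val_mul, hb]
      by_cases h0 : N.val a = 0
      · simp [h0]
      · field_simp
  refine ⟨f, hf, fun a => ?_⟩
  obtain ⟨h1, h2⟩ := h a
  simp only [N.val_mul] at h1 h2
  by_cases h0 : N.val a = 0
  · rw [h0] at h2 ⊢
    simpa using h2.symm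
  · refine eq_inv_of_mul_eq_one_left ?_
    have : N.val a * (N.val (f a) * N.val a) = N.val a * 1 := by linear_combination h1
    exact mul_left_cancel₀ h0 this

/-- Let `i` be an embedding of a field `K` into an effectively numbered field `E`, and let `K` be
generated by a sequence `s` for which codes of `i (s n)` can be computed from `n`. Then `K` has an
effective numbering for which `i` is computable: a number codes a straight-line program that builds
an element from `-1` and the `s n` by the field operations. -/
theorem exists_numbering_of_closure_eq_top {K : Type*} [Field K] (i : K →+* E) {s : ℕ → K}
    (hs : Subfield.closure (Set.range s) = ⊤) {r : ℕ → α} (hr : Computable r)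
    (hrs : ∀ n, N.val (r n) = i (s n)) :
    ∃ (M : EffectiveNumbering K ℕ) (G : ℕ → α), Computable G ∧
      ∀ n, N.val (G n) = i (M.val n) := by
  obtain ⟨inv, hinv, hval_inv⟩ := N.exists_computable_inv
  obtain ⟨m, hm⟩ := N.surjective (i (-1))
  -- The number `pair (pair k l) t` codes an instruction with tag `t` that operates on the values
  -- with the numbers `k` and `l`.
  let x : List α → α := fun L => (L[L.length.unpair.1.unpair.1]?).getD m
  let y : List α → α := fun L => (L[L.length.unpair.1.unpair.2]?).getD m
  let op : List α → ℕ → α := fun L t =>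
    Nat.casesOn t m fun t => Nat.casesOn t (N.add (x L) (y L)) fun t =>
      Nat.casesOn t (N.mul (x L) (y L)) fun t => Nat.casesOn t (inv (x L)) fun t => r t
  let step : List α → α := fun L => op L L.length.unpair.2
  have hlen : Computable fun L : List α => L.length.unpair.1.unpair :=
    Computable.unpair.comp (Computable.fst.comp (Computable.unpair.comp Computable.list_length))
  have hx : Computable x := Computable.option_getD
    (Computable.list_getElem?.comp Computable.id (Computable.fst.comp hlen)) (Computable.const m)
  have hy : Computable y := Computable.option_getD
    (Computable.list_getElem?.comp Computable.id (Computable.snd.comp hlen)) (Computable.const m)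
  have hop : Computable₂ op := by
    refine Computable.nat_casesOn Computable.snd (Computable.const m) ?_
    refine Computable.nat_casesOn Computable.snd
      (N.computable_add.comp (hx.comp (Computable.fst.comp Computable.fst))
        (hy.comp (Computable.fst.comp Computable.fst))) ?_
    refine Computable.nat_casesOn Computable.snd
      (N.computable_mul.comp
        (hx.comp (Computable.fst.comp (Computable.fst.comp Computable.fst)))
        (hy.comp (Computable.fst.comp (Computable.fst.comp Computable.fst)))) ?_
    exact Computable.nat_casesOn Computable.snd
      (hinv.comp (hx.comp (Computable.fst.comp (Computable.fst.comp
        (Computable.fst.comp Computable.fst))))) (hr.comp Computable.snd).to₂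
  have hstep : Computable step :=
    hop.comp Computable.id (Computable.snd.comp (Computable.unpair.comp Computable.list_length))
  let vals : ℕ → List α := fun n => Nat.rec [] (fun _ L => L ++ [step L]) n
  have hvals : Computable vals := Computable.nat_rec Computable.id (Computable.const [])
    (Computable.list_concat.comp (Computable.snd.comp Computable.snd)
      (hstep.comp (Computable.snd.comp Computable.snd))).to₂
  let G : ℕ → α := fun n => step (vals n)
  have hG : Computable G := hstep.comp hvals
  have vals_succ : ∀ n, vals (n + 1) = vals n ++ [G n] := fun n => rfl
  have length_vals : ∀ n, (vals n).length = n := by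
    intro n
    induction n with
    | zero => rfl
    | succ n ih => rw [vals_succ, List.length_append, ih, List.length_singleton]
  have getElem_vals : ∀ n k, k < n → (vals n)[k]? = some (G k) := by
    intro n k hk
    induction n with
    | zero => omega
    | succ n ih =>
      rw [vals_succ]
      rcases Nat.lt_succ_iff_lt_or_eq.1 hk with h | rfl
      · rw [List.getElem?_append_left (by rw [length_vals]; exact h), ih h]
      · rw [List.getElem?_append_right (by rw [length_vals]), length_vals]
        simp
  have G_eq : ∀ k l t, G (Nat.pair (Nat.pair k l) (t + 1)) =
      Nat.casesOn t (N.add (G k) (G l)) fun t =>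
        Nat.casesOn t (N.mul (G k) (G l)) fun t => Nat.casesOn t (inv (G k)) fun t => r t := by
    intro k l t
    have hlt : Nat.pair k l < Nat.pair (Nat.pair k l) (t + 1) := by
      have h := Nat.unpair_lt (n := Nat.pair (Nat.pair k l) (t + 1))
        (le_trans (by omega) (Nat.right_le_pair _ (t + 1)))
      rwa [Nat.unpair_pair] at h
    have hk := (Nat.left_le_pair k l).trans_lt hlt
    have hl := (Nat.right_le_pair k l).trans_lt hlt
    have hxk : x (vals (Nat.pair (Nat.pair k l) (t + 1))) = G k := by
      simp only [x, length_vals, Nat.unpair_pair]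
      rw [getElem_vals _ _ hk]
      rfl
    have hyl : y (vals (Nat.pair (Nat.pair k l) (t + 1))) = G l := by
      simp only [y, length_vals, Nat.unpair_pair]
      rw [getElem_vals _ _ hl]
      rfl
    simp only [G, step, op, length_vals, Nat.unpair_pair, hxk, hyl]
  have hmem : ∀ n, ∃ z : K, N.val (G n) = i z := by
    intro n
    induction n using Nat.strong_induction_on with
    | _ n ih =>
      obtain ⟨p, t, rfl⟩ : ∃ p t, n = Nat.pair p t := ⟨_, _, (Nat.pair_unpair n).symm⟩
      obtain ⟨k, l, rfl⟩ : ∃ k l, p = Nat.pair k l := ⟨_, _, (Nat.pair_unpair p).symm⟩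
      rcases t with _ | t
      · refine ⟨-1, ?_⟩
        simp only [G, step, op, length_vals, Nat.unpair_pair]
        exact hm
      have hlt : Nat.pair k l < Nat.pair (Nat.pair k l) (t + 1) := by
        have h := Nat.unpair_lt (n := Nat.pair (Nat.pair k l) (t + 1))
          (le_trans (by omega) (Nat.right_le_pair _ (t + 1)))
        rwa [Nat.unpair_pair] at h
      obtain ⟨u, hu⟩ := ih k ((Nat.left_le_pair k l).trans_lt hlt)
      obtain ⟨v, hv⟩ := ih l ((Nat.right_le_pair k l).trans_lt hlt)
      rw [G_eq]
      rcases t with _ | _ | _ | t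
      · exact ⟨u + v, by simp [N.val_add, hu, hv]⟩
      · exact ⟨u * v, by simp [N.val_mul, hu, hv]⟩
      · exact ⟨u⁻¹, by simp [hval_inv, hu]⟩
      · exact ⟨s t, hrs t⟩
  choose val hval using hmem
  have hsurj : Function.Surjective val := by
    suffices h : ∀ z : K, ∃ n, N.val (G n) = i z by
      intro z
      obtain ⟨n, hn⟩ := h z
      exact ⟨n, i.injective ((hval n).symm.trans hn)⟩
    intro z
    have hz : z ∈ Subfield.closure (Set.range s) := hs ▸ Subfield.mem_top z
    have h_neg : ∃ n, N.val (G n) = i (-1) :=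
      ⟨0, by simp only [G, step, op, length_vals, Nat.unpair_zero]; exact hm⟩
    have h_add : ∀ u v : K, (∃ n, N.val (G n) = i u) → (∃ n, N.val (G n) = i v) →
        ∃ n, N.val (G n) = i (u + v) := by
      rintro u v ⟨k, hk⟩ ⟨l, hl⟩
      exact ⟨Nat.pair (Nat.pair k l) 1, by rw [G_eq]; simp [N.val_add, hk, hl]⟩
    have h_mul : ∀ u v : K, (∃ n, N.val (G n) = i u) → (∃ n, N.val (G n) = i v) →
        ∃ n, N.val (G n) = i (u * v) := by
      rintro u v ⟨k, hk⟩ ⟨l, hl⟩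
      exact ⟨Nat.pair (Nat.pair k l) 2, by rw [G_eq]; simp [N.val_mul, hk, hl]⟩
    induction hz using Subfield.closure_induction with
    | mem z hz =>
      obtain ⟨n, rfl⟩ := hz
      exact ⟨Nat.pair (Nat.pair 0 0) (n + 4), by rw [G_eq]; exact hrs n⟩
    | one => simpa using h_mul _ _ h_neg h_neg
    | add u v _ _ hu hv => exact h_add u v hu hv
    | neg u _ hu => simpa using h_mul _ _ h_neg hu
    | inv u _ hu =>
      obtain ⟨k, hk⟩ := hu
      exact ⟨Nat.pair (Nat.pair k 0) 3, by rw [G_eq, map_inv₀, ← hk]; exact hval_inv _⟩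
    | mul u v _ _ hu hv => exact h_mul u v hu hv
  have hpair : ∀ t, Computable₂ fun k l : ℕ => Nat.pair (Nat.pair k l) t := fun t =>
    (Primrec₂.natPair.comp (Primrec₂.natPair.comp Primrec.fst Primrec.snd)
      (Primrec.const t)).to_comp
  refine ⟨⟨val, hsurj, fun k l => Nat.pair (Nat.pair k l) 1, fun k l => Nat.pair (Nat.pair k l) 2,
    hpair 1, hpair 2, fun k l => i.injective ?_, fun k l => i.injective ?_, ?_⟩, G, hG, hval⟩
  · rw [← hval, G_eq, map_add, ← hval, ← hval]
    exact N.val_add _ _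
  · rw [← hval, G_eq, map_mul, ← hval, ← hval]
    exact N.val_mul _ _
  · refine (N.semiDec_eq.comp ((hG.comp Computable.fst).pair (hG.comp Computable.snd))).of_eq ?_
    rintro ⟨k, l⟩
    simp only [hval]
    exact i.injective.eq_iff

end EffectiveNumbering

/-! ### Codes for positive real algebraic numbers -/

section NatPolynomials

variable {p q : ℕ[X]} {l u : ℝ}

theorem aeval_natPolynomial_mono (p : ℕ[X]) (hl : 0 ≤ l) (h : l ≤ u) :
    aeval l p ≤ aeval u p := by
  simp only [aeval_eq_sum_range]
  gcongr

/-- On the nonnegative reals the derivatives of `p` and `q` are monotone, so a single comparison of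
their values at the two ends of an interval makes `p - q` strictly increasing there. -/
theorem strictMonoOn_aeval_sub (hl : 0 ≤ l)
    (h : aeval u (derivative q) < aeval l (derivative p)) :
    StrictMonoOn (fun x : ℝ => aeval x p - aeval x q) (Set.Icc l u) := by
  have hd : ∀ x : ℝ, HasDerivAt (fun x : ℝ => aeval x p - aeval x q)
      (aeval x (derivative p) - aeval x (derivative q)) x :=
    fun x => (p.hasDerivAt_aeval x).sub (q.hasDerivAt_aeval x)
  refine strictMonoOn_of_deriv_pos (convex_Icc l u)
    (fun x _ => (hd x).continuousAt.continuousWithinAt) fun x hx => ?_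
  rw [interior_Icc] at hx
  rw [(hd x).deriv, sub_pos]
  exact (aeval_natPolynomial_mono _ (hl.trans hx.1.le) hx.2.le).trans_lt
    (h.trans_le (aeval_natPolynomial_mono _ hl hx.1.le))

end NatPolynomials

/-- The polynomial with the given list of coefficients, constant coefficient first. -/
noncomputable def natPoly (L : List ℕ) : ℕ[X] :=
  L.foldr (fun a p => C a + X * p) 0

/-- Numerators of the values at `a / b` of the polynomial with coefficients `L` and of its
derivative, and their common denominator. -/
def evalFraction (a b : ℕ) (L : List ℕ) : ℕ × ℕ × ℕ :=
  L.foldr (fun c r => (c * b * r.2.2 + a * r.1, b * r.1 + a * r.2.1, b * r.2.2)) (0, 0, 1)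

theorem evalFraction_spec (a : ℕ) {b : ℕ} (hb : 0 < b) (L : List ℕ) :
    0 < (evalFraction a b L).2.2 ∧
    aeval (a / b : ℝ) (natPoly L) = (evalFraction a b L).1 / (evalFraction a b L).2.2 ∧
    aeval (a / b : ℝ) (derivative (natPoly L)) =
      (evalFraction a b L).2.1 / (evalFraction a b L).2.2 := by
  induction L with
  | nil => simp [evalFraction, natPoly]
  | cons c L ih =>
    obtain ⟨h0, h1, h2⟩ := ih
    have hP : natPoly (c :: L) = C c + X * natPoly L := rfl
    have hE : evalFraction a b (c :: L) = (c * b * (evalFraction a b L).2.2 +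
      a * (evalFraction a b L).1, b * (evalFraction a b L).1 + a * (evalFraction a b L).2.1,
      b * (evalFraction a b L).2.2) := rfl
    have hb' : (b : ℝ) ≠ 0 := by positivity
    have h0' : ((evalFraction a b L).2.2 : ℝ) ≠ 0 := by positivity
    rw [hP, hE]
    refine ⟨by positivity, ?_, ?_⟩
    · simp only [map_add, map_mul, aeval_X, aeval_C, h1]
      push_cast
      simp only [eq_natCast]
      field_simp
    · simp only [derivative_C, derivative_mul, derivative_X, map_add, map_mul,
        aeval_X, h1, h2, map_zero, map_one]
      push_cast
      field_simp
      ring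

theorem primrec_evalFraction {α : Type*} [Primcodable α] {a b : α → ℕ} {L : α → List ℕ}
    (ha : Primrec a) (hb : Primrec b) (hL : Primrec L) :
    Primrec fun x => evalFraction (a x) (b x) (L x) := by
  have hc : Primrec fun y : α × ℕ × ℕ × ℕ × ℕ => y.2.1 := Primrec.fst.comp Primrec.snd
  have hr : Primrec fun y : α × ℕ × ℕ × ℕ × ℕ => y.2.2 := Primrec.snd.comp Primrec.snd
  have hr1 := Primrec.fst.comp hr
  have hr2 := Primrec.fst.comp (Primrec.snd.comp hr)
  have hr3 := Primrec.snd.comp (Primrec.snd.comp hr)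
  have ha' : Primrec fun y : α × ℕ × ℕ × ℕ × ℕ => a y.1 := ha.comp Primrec.fst
  have hb' : Primrec fun y : α × ℕ × ℕ × ℕ × ℕ => b y.1 := hb.comp Primrec.fst
  exact Primrec.list_foldr (h := fun x (y : ℕ × ℕ × ℕ × ℕ) =>
      (y.1 * b x * y.2.2.2 + a x * y.2.1, b x * y.2.1 + a x * y.2.2.1, b x * y.2.2.2))
    hL (Primrec.const (0, 0, 1))
    ((Primrec.nat_add.comp (Primrec.nat_mul.comp (Primrec.nat_mul.comp hc hb') hr3)
        (Primrec.nat_mul.comp ha' hr1)).pair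
      ((Primrec.nat_add.comp (Primrec.nat_mul.comp hb' hr1) (Primrec.nat_mul.comp ha' hr2)).pair
        (Primrec.nat_mul.comp hb' hr3))).to₂

/-- A code `((P, Q), a, b)` stands for the root of the polynomial with coefficients `P - Q` in the
interval from `a / (b + 1)` to `(a + 2) / (b + 1)`. Positive and negative coefficients are kept
apart because both parts are then monotone on the positive reals. An interval of length two units
is used so that every positive real lies in the interior of one for each `b`. -/
abbrev RootCode := (List ℕ × List ℕ) × ℕ × ℕ

namespace RootCode

noncomputable section

/-- The part of the polynomial with positive coefficients. -/
def pos (c : RootCode) : ℕ[X] := natPoly c.1.1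

/-- The part of the polynomial with negative coefficients, with the sign changed. -/
def neg (c : RootCode) : ℕ[X] := natPoly c.1.2

/-- The left end of the interval. -/
def lo (c : RootCode) : ℝ := c.2.1 / (c.2.2 + 1)

/-- The right end of the interval. -/
def hi (c : RootCode) : ℝ := (c.2.1 + 2) / (c.2.2 + 1)

theorem lo_nonneg (c : RootCode) : 0 ≤ c.lo := by unfold lo; positivity

theorem lo_lt_hi (c : RootCode) : c.lo < c.hi := by
  unfold lo hi
  gcongr
  linarith

/-- The polynomial changes sign on the interval, and the derivatives at the two ends show that it
is strictly increasing there. -/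
def IsValid (c : RootCode) : Prop :=
  aeval c.lo c.pos < aeval c.lo c.neg ∧ aeval c.hi c.neg < aeval c.hi c.pos ∧
    aeval c.hi (derivative c.neg) < aeval c.lo (derivative c.pos)

theorem primrecPred_isValid : PrimrecPred IsValid := by
  have hP : Primrec fun c : RootCode => c.1.1 := Primrec.fst.comp Primrec.fst
  have hQ : Primrec fun c : RootCode => c.1.2 := Primrec.snd.comp Primrec.fst
  have ha : Primrec fun c : RootCode => c.2.1 := Primrec.fst.comp Primrec.snd
  have ha2 : Primrec fun c : RootCode => c.2.1 + 2 := Primrec.nat_add.comp ha (Primrec.const 2)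
  have hb : Primrec fun c : RootCode => c.2.2 + 1 :=
    Primrec.succ.comp (Primrec.snd.comp Primrec.snd)
  have e1 := primrec_evalFraction ha hb hP
  have e2 := primrec_evalFraction ha hb hQ
  have e3 := primrec_evalFraction ha2 hb hP
  have e4 := primrec_evalFraction ha2 hb hQ
  have d (f : RootCode → ℕ × ℕ × ℕ) (hf : Primrec f) : Primrec fun c => (f c).2.2 :=
    Primrec.snd.comp (Primrec.snd.comp hf)
  have w (f : RootCode → ℕ × ℕ × ℕ) (hf : Primrec f) : Primrec fun c => (f c).2.1 :=
    Primrec.fst.comp (Primrec.snd.comp hf)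
  refine ((Primrec.nat_lt.comp (Primrec.nat_mul.comp (Primrec.fst.comp e1) (d _ e2))
      (Primrec.nat_mul.comp (Primrec.fst.comp e2) (d _ e1))).and
    ((Primrec.nat_lt.comp (Primrec.nat_mul.comp (Primrec.fst.comp e4) (d _ e3))
      (Primrec.nat_mul.comp (Primrec.fst.comp e3) (d _ e4))).and
    (Primrec.nat_lt.comp (Primrec.nat_mul.comp (w _ e4) (d _ e1))
      (Primrec.nat_mul.comp (w _ e1) (d _ e4))))).of_eq fun c => ?_
  have hlo : c.lo = ((c.2.1 : ℕ) : ℝ) / ((c.2.2 + 1 : ℕ) : ℝ) := by simp [lo]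
  have hhi : c.hi = ((c.2.1 + 2 : ℕ) : ℝ) / ((c.2.2 + 1 : ℕ) : ℝ) := by simp [hi]
  have f1 := evalFraction_spec c.2.1 (Nat.succ_pos c.2.2) c.1.1
  have f2 := evalFraction_spec c.2.1 (Nat.succ_pos c.2.2) c.1.2
  have f3 := evalFraction_spec (c.2.1 + 2) (Nat.succ_pos c.2.2) c.1.1
  have f4 := evalFraction_spec (c.2.1 + 2) (Nat.succ_pos c.2.2) c.1.2
  simp only [Nat.succ_eq_add_one] at f1 f2 f3 f4
  have cmp : ∀ {x y z t : ℕ}, 0 < y → 0 < t → ((x : ℝ) / y < z / t ↔ x * t < z * y) := by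
    intro x y z t hy ht
    rw [div_lt_div_iff₀ (by positivity) (by positivity)]
    norm_cast
  unfold IsValid pos neg
  rw [hlo, hhi, f1.2.1, f1.2.2, f2.2.1, f3.2.1, f4.2.1, f4.2.2, cmp f1.1 f2.1, cmp f4.1 f3.1,
    cmp f4.1 f1.1]

/-- `IsRoot c x` says that `x` is a root of the polynomial of `c` in the interval of `c`. -/
def IsRoot (c : RootCode) (x : ℝ) : Prop :=
  c.lo < x ∧ x < c.hi ∧ aeval x c.pos = aeval x c.neg

theorem IsValid.strictMonoOn {c : RootCode} (h : c.IsValid) :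
    StrictMonoOn (fun x : ℝ => aeval x c.pos - aeval x c.neg) (Set.Icc c.lo c.hi) :=
  strictMonoOn_aeval_sub c.lo_nonneg h.2.2

theorem IsValid.exists_isRoot {c : RootCode} (h : c.IsValid) : ∃ x, c.IsRoot x := by
  have hc : ContinuousOn (fun x : ℝ => aeval x c.pos - aeval x c.neg) (Set.Icc c.lo c.hi) :=
    ((c.pos.continuous_aeval).sub (c.neg.continuous_aeval)).continuousOn
  obtain ⟨x, hx, hx0⟩ := intermediate_value_Ioo c.lo_lt_hi.le hc
    (show (0 : ℝ) ∈ _ from ⟨sub_neg.2 h.1, sub_pos.2 h.2.1⟩)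
  exact ⟨x, hx.1, hx.2, sub_eq_zero.1 hx0⟩

theorem IsValid.isRoot_unique {c : RootCode} (h : c.IsValid) {x y : ℝ} (hx : c.IsRoot x)
    (hy : c.IsRoot y) : x = y :=
  h.strictMonoOn.injOn ⟨hx.1.le, hx.2.1.le⟩ ⟨hy.1.le, hy.2.1.le⟩ <| by
    simp only [hx.2.2, hy.2.2, sub_self]

theorem IsRoot.pos {c : RootCode} {x : ℝ} (hx : c.IsRoot x) : 0 < x := c.lo_nonneg.trans_lt hx.1

/-- Around a positive simple root at which `P - Q` is increasing, all sufficiently short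
intervals are valid. -/
theorem eventually_isValid {P Q : List ℕ} {x : ℝ} (hx : 0 < x)
    (h0 : aeval x (natPoly P) = aeval x (natPoly Q))
    (h1 : aeval x (derivative (natPoly Q)) < aeval x (derivative (natPoly P)))
    {l u : ℝ} (hl : l < x) (hu : x < u) :
    ∀ᶠ b : ℕ in Filter.atTop, ∃ a : ℕ, IsValid ((P, Q), a, b) ∧ IsRoot ((P, Q), a, b) x ∧
      l ≤ lo ((P, Q), a, b) ∧ hi ((P, Q), a, b) ≤ u := by
  have hQ : ∀ᶠ y in nhds x, aeval y (derivative (natPoly Q)) <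
      (aeval x (derivative (natPoly Q)) + aeval x (derivative (natPoly P))) / 2 :=
    ((derivative (natPoly Q)).continuous_aeval.tendsto x).eventually_lt_const (by linarith)
  have hP : ∀ᶠ y in nhds x, (aeval x (derivative (natPoly Q)) +
      aeval x (derivative (natPoly P))) / 2 < aeval y (derivative (natPoly P)) :=
    ((derivative (natPoly P)).continuous_aeval.tendsto x).eventually_const_lt (by linarith)
  obtain ⟨ε, hε, hball⟩ := Metric.eventually_nhds_iff.1
    ((hQ.and hP).and ((lt_mem_nhds hl).and (gt_mem_nhds hu)))
  obtain ⟨B, hB⟩ := exists_nat_gt (2 / ε)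
  refine Filter.eventually_atTop.2 ⟨B, fun b hb => ?_⟩
  have hb0 : (0 : ℝ) < b + 1 := by positivity
  have hbε : 2 / ((b : ℝ) + 1) < ε := by
    rw [div_lt_iff₀ hε] at hB
    rw [div_lt_iff₀ hb0]
    have : (B : ℝ) ≤ b := by exact_mod_cast hb
    nlinarith
  obtain ⟨a, ha⟩ : ∃ a, ⌈x * (b + 1)⌉₊ = a + 1 :=
    Nat.exists_eq_succ_of_ne_zero (Nat.ceil_pos.2 (by positivity)).ne'
  have ha1 : x * (b + 1) ≤ a + 1 := by exact_mod_cast ha ▸ Nat.le_ceil (x * (b + 1))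
  have ha2 : (a : ℝ) < x * (b + 1) := by
    have := Nat.ceil_lt_add_one (show 0 ≤ x * (b + 1) by positivity)
    rw [ha] at this
    push_cast at this
    linarith
  set c : RootCode := ((P, Q), a, b) with hc
  have hlo : c.lo < x := by
    rw [lo, div_lt_iff₀ hb0]
    exact ha2
  have hhi : x < c.hi := by
    rw [hi, lt_div_iff₀ hb0]
    change x * (b + 1) < (a : ℝ) + 2
    linarith
  have hdiff : c.hi = c.lo + 2 / ((b : ℝ) + 1) := by
    rw [hi, lo]
    exact add_div _ _ _
  have hdlo : dist c.lo x < ε := by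
    rw [Real.dist_eq, abs_lt]
    constructor <;> linarith
  have hdhi : dist c.hi x < ε := by
    rw [Real.dist_eq, abs_lt]
    constructor <;> linarith
  have hslope : aeval c.hi (derivative c.neg) < aeval c.lo (derivative c.pos) :=
    (hball hdhi).1.1.trans (hball hdlo).1.2
  have hmono := strictMonoOn_aeval_sub (p := c.pos) (q := c.neg) c.lo_nonneg hslope
  have hx0 : aeval x c.pos - aeval x c.neg = 0 := sub_eq_zero.2 h0
  have hxI : x ∈ Set.Icc c.lo c.hi := ⟨hlo.le, hhi.le⟩
  refine ⟨a, ⟨?_, ?_, hslope⟩, ⟨hlo, hhi, h0⟩, (hball hdlo).2.1.le, (hball hdhi).2.2.le⟩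
  · have := hmono (Set.left_mem_Icc.2 c.lo_lt_hi.le) hxI hlo
    simp only [hx0] at this
    exact sub_neg.1 this
  · have := hmono hxI (Set.right_mem_Icc.2 c.lo_lt_hi.le) hhi
    simp only [hx0] at this
    exact sub_pos.1 this

/-- A valid code of the number one: the root of `X - 1` between `0` and `2`. -/
def one : RootCode := (([0, 1], [1]), 0, 0)

theorem isValid_one : one.IsValid := by
  simp [IsValid, one, lo, hi, RootCode.pos, RootCode.neg, natPoly]

open Classical in
/-- Replaces an invalid code by a code of the number one. -/
def normalize (c : RootCode) : RootCode := if c.IsValid then c else one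

theorem isValid_normalize (c : RootCode) : c.normalize.IsValid := by
  unfold normalize
  split_ifs with h
  exacts [h, isValid_one]

theorem normalize_of_isValid {c : RootCode} (h : c.IsValid) : c.normalize = c := if_pos h

theorem computable_normalize : Computable normalize := by
  obtain ⟨_, h⟩ := primrecPred_isValid
  refine (Primrec.ite (c := IsValid) primrecPred_isValid Primrec.id
    (Primrec.const one)).to_comp.of_eq fun c => ?_
  unfold normalize
  congr

/-- The positive real number denoted by a code. -/
def val (c : RootCode) : ℝ := c.isValid_normalize.exists_isRoot.choose

theorem isRoot_val_normalize (c : RootCode) : c.normalize.IsRoot c.val :=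
  c.isValid_normalize.exists_isRoot.choose_spec

theorem IsValid.isRoot_val {c : RootCode} (h : c.IsValid) : c.IsRoot c.val := by
  have := c.isRoot_val_normalize
  rwa [normalize_of_isValid h] at this

theorem IsValid.val_eq {c : RootCode} (h : c.IsValid) {x : ℝ} (hx : c.IsRoot x) : c.val = x :=
  h.isRoot_unique h.isRoot_val hx

theorem val_normalize (c : RootCode) : c.normalize.val = c.val :=
  c.isValid_normalize.val_eq c.isRoot_val_normalize

theorem val_pos (c : RootCode) : 0 < c.val := c.isRoot_val_normalize.pos

theorem val_one : one.val = 1 :=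
  isValid_one.val_eq <| by
    simp [IsRoot, one, lo, hi, RootCode.pos, RootCode.neg, natPoly]

theorem exists_natPoly_eq (p : ℕ[X]) : ∃ L, natPoly L = p := by
  induction h : p.natDegree using Nat.strong_induction_on generalizing p with
  | _ n ih =>
    by_cases hp : p.divX = 0
    · refine ⟨[p.coeff 0], ?_⟩
      conv_rhs => rw [← p.X_mul_divX_add, hp]
      simp [natPoly]
    · have hn : p.natDegree ≠ 0 := fun h0 => hp <| by
        rw [eq_C_of_natDegree_eq_zero h0, divX_C]
      obtain ⟨L, hL⟩ := ih _ (by rw [natDegree_divX_eq_natDegree_tsub_one]; omega) p.divX rfl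
      refine ⟨p.coeff 0 :: L, ?_⟩
      conv_rhs => rw [← p.X_mul_divX_add]
      rw [← hL, add_comm]
      rfl

theorem exists_natPoly_sub (f : ℤ[X]) : ∃ P Q : List ℕ,
    f = (natPoly P).map (Nat.castRingHom ℤ) - (natPoly Q).map (Nat.castRingHom ℤ) := by
  suffices h : ∃ p q : ℕ[X], f = p.map (Nat.castRingHom ℤ) - q.map (Nat.castRingHom ℤ) by
    obtain ⟨p, q, h⟩ := h
    obtain ⟨P, rfl⟩ := exists_natPoly_eq p
    obtain ⟨Q, rfl⟩ := exists_natPoly_eq q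
    exact ⟨P, Q, h⟩
  induction f using Polynomial.induction_on' with
  | add f g hf hg =>
    obtain ⟨p, q, rfl⟩ := hf
    obtain ⟨p', q', rfl⟩ := hg
    exact ⟨p + p', q + q', by simp only [Polynomial.map_add]; ring⟩
  | monomial n a =>
    refine ⟨monomial n a.toNat, monomial n (-a).toNat, ?_⟩
    simp only [map_monomial, ← map_sub, eq_natCast]
    congr 1
    omega

/-- Every positive real algebraic number has a code. -/
theorem exists_val_eq {x : ℝ} (hx : 0 < x) (halg : IsAlgebraic ℚ x) : ∃ c, val c = x := by
  -- The minimal polynomial has a simple root at `x`; clearing denominators and choosing the sign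
  -- gives an integer polynomial with a positive derivative there.
  obtain ⟨f, hf0, hf1⟩ : ∃ f : ℤ[X], aeval x f = 0 ∧ 0 < aeval x (derivative f) := by
    have hirr := minpoly.irreducible halg.isIntegral
    have hsep := hirr.separable
    obtain ⟨b, hb, hint⟩ := IsLocalization.integerNormalization_spec (nonZeroDivisors ℤ)
      (minpoly ℚ x)
    set g := IsLocalization.integerNormalization (nonZeroDivisors ℤ) (minpoly ℚ x)
    have hd : aeval x (derivative (minpoly ℚ x)) ≠ 0 :=
      hsep.aeval_derivative_ne_zero (minpoly.aeval ℚ x)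
    have hb0 : b ≠ 0 := nonZeroDivisors.ne_zero hb
    have hg0 : aeval x g = 0 := by
      rw [← aeval_map_algebraMap ℚ, hint, map_zsmul, minpoly.aeval, smul_zero]
    have hg1 : aeval x (derivative g) ≠ 0 := by
      rw [← aeval_map_algebraMap ℚ, ← derivative_map, hint, derivative_smul, map_zsmul]
      exact smul_ne_zero hb0 hd
    rcases lt_or_gt_of_ne hg1 with h | h
    · exact ⟨-g, by simp [hg0], by simpa using h⟩
    · exact ⟨g, hg0, h⟩
  obtain ⟨P, Q, rfl⟩ := exists_natPoly_sub f
  have cast : ∀ p : ℕ[X], aeval x (p.map (Nat.castRingHom ℤ)) = aeval x p := fun p => by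
    rw [aeval_def, aeval_def, eval₂_map]
    congr 1
  rw [map_sub, cast, cast, sub_eq_zero] at hf0
  rw [derivative_sub, derivative_map, derivative_map, map_sub, cast, cast, sub_pos] at hf1
  obtain ⟨b, a, hv, hr, -⟩ :=
    (eventually_isValid hx hf0 hf1 (sub_one_lt x) (lt_add_one x)).exists
  exact ⟨_, hv.val_eq hr⟩

end

end RootCode

/-! ### A lower bound for nonzero algebraic numbers -/

/-- The norm of a nonzero algebraic integer is a nonzero integer, so an algebraic integer with
bounded conjugates cannot be too small. -/
theorem one_le_norm_mul_pow {K : IntermediateField ℚ ℂ} [FiniteDimensional ℚ K] {w : K}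
    (hw : w ≠ 0) (hint : IsIntegral ℤ w) {M : ℝ} (hb : ∀ σ : K →ₐ[ℚ] ℂ, ‖σ w‖ ≤ M) :
    1 ≤ ‖(w : ℂ)‖ * M ^ (Module.finrank ℚ K - 1) := by
  classical
  have hprod : algebraMap ℚ ℂ (Algebra.norm ℚ w) = ∏ σ : K →ₐ[ℚ] ℂ, σ w :=
    Algebra.norm_eq_prod_embeddings ℚ ℂ w
  obtain ⟨n, hn⟩ := IsIntegrallyClosed.isIntegral_iff.1 (Algebra.isIntegral_norm ℚ hint)
  have hn0 : n ≠ 0 := by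
    rintro rfl
    rw [map_zero] at hn
    exact hw (Algebra.norm_eq_zero_iff.1 hn.symm)
  have h1 : 1 ≤ ∏ σ : K →ₐ[ℚ] ℂ, ‖σ w‖ := by
    rw [← norm_prod, ← hprod, ← hn]
    simp only [eq_intCast, map_intCast, Complex.norm_intCast]
    exact_mod_cast Int.one_le_abs hn0
  refine h1.trans ?_
  let v : K →ₐ[ℚ] ℂ := (algebraMap K ℂ).toRatAlgHom
  rw [← Finset.mul_prod_erase Finset.univ (fun σ : K →ₐ[ℚ] ℂ => ‖σ w‖) (Finset.mem_univ v)]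
  refine mul_le_mul_of_nonneg_left ?_ (norm_nonneg _)
  refine (Finset.prod_le_prod (fun σ _ => norm_nonneg _) fun σ _ => hb σ).trans_eq ?_
  rw [Finset.prod_const, Finset.card_erase_of_mem (Finset.mem_univ _), Finset.card_univ, AlgHom.card]

/-- `IsRootWithBounds y S D` says that `y` is a root of a nonzero integer polynomial of degree at
most `D`, and that `S` bounds its leading coefficient and all its complex roots. -/
def IsRootWithBounds (y : ℂ) (S D : ℕ) : Prop :=
  ∃ f : ℤ[X], f ≠ 0 ∧ aeval y f = 0 ∧ |f.leadingCoeff| ≤ S ∧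
    (∀ z : ℂ, aeval z f = 0 → ‖z‖ ≤ S) ∧ f.natDegree ≤ D

/-- The base of the bound that separates the values of `x + y - z` and `x * y - z` from zero. -/
def separationBound (S₁ S₂ S₃ : ℕ) : ℕ := S₁ * S₂ * S₃ * (S₁ + S₂ + S₃ + S₁ * S₂)

theorem finrank_adjoin_simple_le {y : ℂ} {f : ℤ[X]} (hf : f ≠ 0) (hy : aeval y f = 0) :
    IsIntegral ℚ y ∧ Module.finrank ℚ (IntermediateField.adjoin ℚ {y}) ≤ f.natDegree := by
  have hf' : f.map (algebraMap ℤ ℚ) ≠ 0 :=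
    (Polynomial.map_ne_zero_iff (algebraMap ℤ ℚ).injective_int).2 hf
  have hy' : aeval y (f.map (algebraMap ℤ ℚ)) = 0 := by rwa [aeval_map_algebraMap]
  have hint : IsIntegral ℚ y := (show IsAlgebraic ℚ y from ⟨_, hf', hy'⟩).isIntegral
  refine ⟨hint, ?_⟩
  rw [IntermediateField.adjoin.finrank hint]
  exact (natDegree_le_of_dvd (minpoly.dvd ℚ y hy') hf').trans natDegree_map_le

theorem one_le_norm_mul_separationBound_pow {y₁ y₂ y₃ : ℂ} {S₁ S₂ S₃ D₁ D₂ D₃ : ℕ}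
    (h₁ : IsRootWithBounds y₁ S₁ D₁) (h₂ : IsRootWithBounds y₂ S₂ D₂)
    (h₃ : IsRootWithBounds y₃ S₃ D₃) {t : ℂ} (ht : t = y₁ + y₂ ∨ t = y₁ * y₂) (hne : t ≠ y₃) :
    1 ≤ ‖t - y₃‖ * (separationBound S₁ S₂ S₃ : ℝ) ^ (D₁ * D₂ * D₃) := by
  obtain ⟨f₁, hf₁, hy₁, hl₁, hr₁, hd₁⟩ := h₁
  obtain ⟨f₂, hf₂, hy₂, hl₂, hr₂, hd₂⟩ := h₂
  obtain ⟨f₃, hf₃, hy₃, hl₃, hr₃, hd₃⟩ := h₃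
  obtain ⟨i₁, n₁⟩ := finrank_adjoin_simple_le hf₁ hy₁
  obtain ⟨i₂, n₂⟩ := finrank_adjoin_simple_le hf₂ hy₂
  obtain ⟨i₃, n₃⟩ := finrank_adjoin_simple_le hf₃ hy₃
  have := IntermediateField.adjoin.finiteDimensional i₁
  have := IntermediateField.adjoin.finiteDimensional i₂
  have := IntermediateField.adjoin.finiteDimensional i₃
  obtain ⟨K, _, hK, m₁, m₂, m₃⟩ : ∃ K : IntermediateField ℚ ℂ, FiniteDimensional ℚ K ∧
      Module.finrank ℚ K ≤ D₁ * D₂ * D₃ ∧ y₁ ∈ K ∧ y₂ ∈ K ∧ y₃ ∈ K :=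
    ⟨IntermediateField.adjoin ℚ {y₁} ⊔ IntermediateField.adjoin ℚ {y₂} ⊔
      IntermediateField.adjoin ℚ {y₃}, inferInstance,
      (IntermediateField.finrank_sup_le _ _).trans <| Nat.mul_le_mul
        ((IntermediateField.finrank_sup_le _ _).trans
          (Nat.mul_le_mul (n₁.trans hd₁) (n₂.trans hd₂))) (n₃.trans hd₃),
      (le_sup_left.trans le_sup_left : IntermediateField.adjoin ℚ {y₁} ≤ _)
        (IntermediateField.mem_adjoin_simple_self ℚ y₁),
      (le_sup_right.trans le_sup_left : IntermediateField.adjoin ℚ {y₂} ≤ _)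
        (IntermediateField.mem_adjoin_simple_self ℚ y₂),
      (le_sup_right : IntermediateField.adjoin ℚ {y₃} ≤ _)
        (IntermediateField.mem_adjoin_simple_self ℚ y₃)⟩
  have hroot : ∀ {f : ℤ[X]} {y : K}, aeval (y : ℂ) f = 0 → aeval y f = 0 := by
    intro f y hy
    have : aeval (K.val y) f = 0 := hy
    rw [← aeval_map_algebraMap ℚ, aeval_algHom_apply, aeval_map_algebraMap] at this
    exact K.val.injective (this.trans (map_zero _).symm)
  have hconj : ∀ {f : ℤ[X]} {y : K}, aeval (y : ℂ) f = 0 → ∀ σ : K →ₐ[ℚ] ℂ,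
      aeval (σ y) f = 0 := by
    intro f y hy σ
    rw [← aeval_map_algebraMap ℚ, aeval_algHom_apply, aeval_map_algebraMap, hroot hy, map_zero]
  have hintK : ∀ {f : ℤ[X]} {y : K}, aeval (y : ℂ) f = 0 →
      IsIntegral ℤ ((f.leadingCoeff : K) * y) := by
    intro f y hy
    simpa [Algebra.smul_def] using isIntegral_leadingCoeff_smul f y (hroot hy)
  have one_le : ∀ {f : ℤ[X]} {S : ℕ}, f ≠ 0 → |f.leadingCoeff| ≤ S → (1 : ℝ) ≤ S := by
    intro f S hf hl
    have := (Int.one_le_abs (leadingCoeff_ne_zero.2 hf)).trans hl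
    exact_mod_cast this
  have s₁ := one_le hf₁ hl₁
  have s₂ := one_le hf₂ hl₂
  have s₃ := one_le hf₃ hl₃
  obtain ⟨x₁, rfl⟩ : ∃ x : K, (x : ℂ) = y₁ := ⟨⟨y₁, m₁⟩, rfl⟩
  obtain ⟨x₂, rfl⟩ : ∃ x : K, (x : ℂ) = y₂ := ⟨⟨y₂, m₂⟩, rfl⟩
  obtain ⟨x₃, rfl⟩ : ∃ x : K, (x : ℂ) = y₃ := ⟨⟨y₃, m₃⟩, rfl⟩
  obtain ⟨x, rfl, hx⟩ : ∃ x : K, (x : ℂ) = t ∧ (x = x₁ + x₂ ∨ x = x₁ * x₂) := by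
    rcases ht with rfl | rfl
    · exact ⟨x₁ + x₂, rfl, Or.inl rfl⟩
    · exact ⟨x₁ * x₂, rfl, Or.inr rfl⟩
  set c₁ := f₁.leadingCoeff with hc₁
  set c₂ := f₂.leadingCoeff with hc₂
  set c₃ := f₃.leadingCoeff with hc₃
  obtain ⟨w, hwdef⟩ : ∃ w : K, w = ((c₁ * c₂ * c₃ : ℤ) : K) * (x - x₃) := ⟨_, rfl⟩
  have hci : ∀ n : ℤ, IsIntegral ℤ (n : K) := fun n => isIntegral_algebraMap
  have hw : IsIntegral ℤ w := by
    have e₁ := hintK hy₁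
    have e₂ := hintK hy₂
    have e₃ := hintK hy₃
    rcases hx with rfl | rfl
    · have e : w = ((c₂ * c₃ : ℤ) : K) * ((c₁ : K) * x₁) +
          ((c₁ * c₃ : ℤ) : K) * ((c₂ : K) * x₂) - ((c₁ * c₂ : ℤ) : K) * ((c₃ : K) * x₃) := by
        rw [hwdef]
        push_cast
        ring
      rw [e]
      exact (((hci (c₂ * c₃)).mul e₁).add ((hci (c₁ * c₃)).mul e₂)).sub ((hci (c₁ * c₂)).mul e₃)
    · have e : w = (c₃ : K) * (((c₁ : K) * x₁) * ((c₂ : K) * x₂)) -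
          ((c₁ * c₂ : ℤ) : K) * ((c₃ : K) * x₃) := by
        rw [hwdef]
        push_cast
        ring
      rw [e]
      exact ((hci c₃).mul (e₁.mul e₂)).sub ((hci (c₁ * c₂)).mul e₃)
  have hc : c₁ * c₂ * c₃ ≠ 0 := mul_ne_zero (mul_ne_zero (leadingCoeff_ne_zero.2 hf₁)
    (leadingCoeff_ne_zero.2 hf₂)) (leadingCoeff_ne_zero.2 hf₃)
  have hw0 : w ≠ 0 := by
    rw [hwdef]
    refine mul_ne_zero (Int.cast_ne_zero.2 hc) (sub_ne_zero.2 ?_)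
    rintro rfl
    exact hne rfl
  have hcS : ‖((c₁ * c₂ * c₃ : ℤ) : ℂ)‖ ≤ S₁ * S₂ * S₃ := by
    have h : |c₁ * c₂ * c₃| ≤ (S₁ * S₂ * S₃ : ℤ) := by
      rw [abs_mul, abs_mul]
      gcongr
    rw [Complex.norm_intCast]
    exact_mod_cast h
  set M : ℝ := (separationBound S₁ S₂ S₃ : ℝ) with hM
  have hMeq : M = S₁ * S₂ * S₃ * (S₁ + S₂ + S₃ + S₁ * S₂) := by
    rw [hM, separationBound]
    push_cast
    rfl
  have h12 : (1 : ℝ) ≤ S₁ * S₂ := one_le_mul_of_one_le_of_one_le s₁ s₂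
  have h123 : (1 : ℝ) ≤ S₁ * S₂ * S₃ := one_le_mul_of_one_le_of_one_le h12 s₃
  have hcM : (S₁ * S₂ * S₃ : ℝ) ≤ M := by
    rw [hMeq]
    exact le_mul_of_one_le_right (by positivity) (by linarith)
  have hM1 : 1 ≤ M := h123.trans hcM
  have hb : ∀ σ : K →ₐ[ℚ] ℂ, ‖σ w‖ ≤ M := by
    intro σ
    have b₁ := hr₁ _ (hconj hy₁ σ)
    have b₂ := hr₂ _ (hconj hy₂ σ)
    have b₃ := hr₃ _ (hconj hy₃ σ)
    have hxσ : ‖σ x‖ ≤ S₁ + S₂ + S₁ * S₂ := by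
      rcases hx with rfl | rfl
      · rw [map_add]
        refine (norm_add_le _ _).trans ?_
        linarith
      · rw [map_mul, norm_mul]
        have := mul_le_mul b₁ b₂ (norm_nonneg _) (by positivity)
        linarith
    rw [hwdef, map_mul, map_intCast, norm_mul, hMeq]
    refine mul_le_mul hcS ?_ (norm_nonneg _) (by positivity)
    rw [map_sub]
    refine (norm_sub_le _ _).trans ?_
    linarith
  have key := one_le_norm_mul_pow hw0 hw hb
  have hwn : ‖(w : ℂ)‖ ≤ M * ‖(x : ℂ) - x₃‖ := by
    have : (w : ℂ) = ((c₁ * c₂ * c₃ : ℤ) : ℂ) * ((x : ℂ) - x₃) := by simp [hwdef]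
    rw [this, norm_mul]
    gcongr
    exact hcS.trans hcM
  have hpos : 0 < Module.finrank ℚ K := Module.finrank_pos
  calc (1 : ℝ) ≤ ‖(w : ℂ)‖ * M ^ (Module.finrank ℚ K - 1) := key
    _ ≤ M * ‖(x : ℂ) - x₃‖ * M ^ (Module.finrank ℚ K - 1) := by gcongr
    _ = ‖(x : ℂ) - x₃‖ * M ^ (Module.finrank ℚ K - 1 + 1) := by ring
    _ ≤ ‖(x : ℂ) - x₃‖ * M ^ (D₁ * D₂ * D₃) := by
      gcongr
      omega

namespace RootCode

theorem coeff_natPoly_le (L : List ℕ) (n : ℕ) : (natPoly L).coeff n ≤ L.sum := by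
  induction L generalizing n with
  | nil => simp [natPoly]
  | cons a L ih =>
    have h : natPoly (a :: L) = C a + X * natPoly L := rfl
    rw [h, List.sum_cons]
    cases n with
    | zero => simp
    | succ n => simpa [coeff_C] using (ih n).trans (Nat.le_add_left _ _)

theorem natDegree_natPoly_le (L : List ℕ) : (natPoly L).natDegree ≤ L.length := by
  induction L with
  | nil => simp [natPoly]
  | cons a L ih =>
    have h : natPoly (a :: L) = C a + X * natPoly L := rfl
    rw [h, natDegree_C_add, List.length_cons]
    refine natDegree_mul_le.trans ?_
    have := natDegree_X_le (R := ℕ)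
    omega

/-- Bounds the leading coefficient and the complex roots of the polynomial of the code. -/
def size (c : RootCode) : ℕ := c.1.1.sum + c.1.2.sum + 1

/-- Bounds the degree of the polynomial of the code. -/
def degreeBound (c : RootCode) : ℕ := c.1.1.length + c.1.2.length

theorem IsValid.isRootWithBounds {c : RootCode} (h : c.IsValid) :
    IsRootWithBounds (c.val : ℂ) c.size c.degreeBound := by
  have hr := h.isRoot_val
  set f : ℤ[X] := c.pos.map (Nat.castRingHom ℤ) - c.neg.map (Nat.castRingHom ℤ) with hf
  have hcast : ∀ (p : ℕ[X]) (x : ℝ), aeval (x : ℂ) (p.map (Nat.castRingHom ℤ)) =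
      ((aeval x p : ℝ) : ℂ) := fun p x => by
    rw [aeval_def, eval₂_map, ← Complex.coe_algebraMap, ← aeval_algebraMap_apply, aeval_def]
    congr 1
  have hfx : ∀ x : ℝ, aeval (x : ℂ) f = ((aeval x c.pos - aeval x c.neg : ℝ) : ℂ) := fun x => by
    rw [hf, map_sub, hcast, hcast]
    push_cast
    rfl
  obtain ⟨m, hm⟩ : ∃ m, c.1.1.sum + c.1.2.sum = m := ⟨_, rfl⟩
  have hsize : c.size = m + 1 := by rw [size, hm]
  have hcoeff : ∀ n, |f.coeff n| ≤ (m : ℤ) := by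
    intro n
    have h1 := coeff_natPoly_le c.1.1 n
    have h2 := coeff_natPoly_le c.1.2 n
    simp only [hf, coeff_sub, coeff_map, eq_natCast, RootCode.pos, RootCode.neg]
    rw [abs_le]
    constructor <;> omega
  have hf0 : f ≠ 0 := by
    intro h0
    have := hfx c.lo
    rw [h0, map_zero] at this
    have h1 := h.1
    have h2 : aeval c.lo c.pos - aeval c.lo c.neg = 0 := by exact_mod_cast this.symm
    linarith
  refine ⟨f, hf0, ?_, ?_, ?_, ?_⟩
  · rw [hfx, hr.2.2, sub_self, Complex.ofReal_zero]
  · refine (hcoeff _).trans ?_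
    rw [hsize]
    push_cast
    omega
  · intro z hz
    have hinj : Function.Injective (algebraMap ℤ ℂ) := (algebraMap ℤ ℂ).injective_int
    have hz' : (f.map (algebraMap ℤ ℂ)).IsRoot z := by rwa [IsRoot.def, eval_map_algebraMap]
    have hlt := hz'.norm_lt_cauchyBound ((Polynomial.map_ne_zero_iff hinj).2 hf0)
    have hle : cauchyBound (f.map (algebraMap ℤ ℂ)) ≤ (c.size : NNReal) := by
      rw [cauchyBound, hsize]
      push_cast
      gcongr
      refine (div_le_self (by positivity) ?_).trans ?_
      · rw [leadingCoeff_map_of_injective hinj, ← NNReal.coe_le_coe]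
        simp only [eq_intCast, coe_nnnorm, NNReal.coe_one, Complex.norm_intCast]
        exact_mod_cast Int.one_le_abs (leadingCoeff_ne_zero.2 hf0)
      · refine Finset.sup_le fun n _ => ?_
        rw [← NNReal.coe_le_coe]
        simp only [coeff_map, eq_intCast, coe_nnnorm, Complex.norm_intCast]
        rw [NNReal.coe_natCast, ← Int.cast_natCast, ← Int.cast_abs]
        exact Int.cast_le.2 (hcoeff n)
    have := hlt.le.trans hle
    exact_mod_cast NNReal.coe_le_coe.2 this
  · refine (natDegree_sub_le _ _).trans (max_le ?_ ?_)
    · exact natDegree_map_le.trans ((natDegree_natPoly_le _).trans (Nat.le_add_right _ _))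
    · exact natDegree_map_le.trans ((natDegree_natPoly_le _).trans (Nat.le_add_left _ _))

end RootCode

/-! ### Computable arithmetic of positive real algebraic numbers -/

namespace RootCode

/-- The interval from `a / (b + 1)` to `(a + 2) / (b + 1)` is a valid one for the polynomial of
`c`, and lies in the interval of `c`. -/
def Approx (c : RootCode) (a b : ℕ) : Prop :=
  IsValid (c.1, a, b) ∧ c.2.1 * (b + 1) ≤ a * (c.2.2 + 1) ∧
    (a + 2) * (c.2.2 + 1) ≤ (c.2.1 + 2) * (b + 1)

theorem primrecPred_approx {α : Type*} [Primcodable α] {c : α → RootCode} {a b : α → ℕ}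
    (hc : Primrec c) (ha : Primrec a) (hb : Primrec b) :
    PrimrecPred fun x => Approx (c x) (a x) (b x) := by
  have h1 : Primrec fun x => (c x).2.1 := Primrec.fst.comp (Primrec.snd.comp hc)
  have h2 : Primrec fun x => (c x).2.2 + 1 :=
    Primrec.succ.comp (Primrec.snd.comp (Primrec.snd.comp hc))
  have hb1 : Primrec fun x => b x + 1 := Primrec.succ.comp hb
  have two : ∀ {f : α → ℕ}, Primrec f → Primrec fun x => f x + 2 :=
    fun hf => Primrec.nat_add.comp hf (Primrec.const 2)
  exact (primrecPred_isValid.comp ((Primrec.fst.comp hc).pair (ha.pair hb))).and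
    ((Primrec.nat_le.comp (Primrec.nat_mul.comp h1 hb1) (Primrec.nat_mul.comp ha h2)).and
    (Primrec.nat_le.comp (Primrec.nat_mul.comp (two ha) h2) (Primrec.nat_mul.comp (two h1) hb1)))

theorem lo_le_lo_iff (c d : RootCode) :
    c.lo ≤ d.lo ↔ c.2.1 * (d.2.2 + 1) ≤ d.2.1 * (c.2.2 + 1) := by
  rw [lo, lo, div_le_div_iff₀ (by positivity) (by positivity)]
  norm_cast

theorem hi_le_hi_iff (c d : RootCode) :
    d.hi ≤ c.hi ↔ (d.2.1 + 2) * (c.2.2 + 1) ≤ (c.2.1 + 2) * (d.2.2 + 1) := by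
  rw [hi, hi, div_le_div_iff₀ (by positivity) (by positivity)]
  norm_cast

theorem Approx.val_mem {c : RootCode} (h : c.IsValid) {a b : ℕ} (ha : c.Approx a b) :
    a < c.val * (b + 1) ∧ c.val * (b + 1) < a + 2 := by
  obtain ⟨hv, h1, h2⟩ := ha
  have hlo := (lo_le_lo_iff c (c.1, a, b)).2 h1
  have hhi := (hi_le_hi_iff c (c.1, a, b)).2 h2
  obtain ⟨x, hx⟩ := hv.exists_isRoot
  have : c.val = x := h.val_eq ⟨hlo.trans_lt hx.1, hx.2.1.trans_le hhi, hx.2.2⟩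
  rw [this]
  exact ⟨(div_lt_iff₀ (by positivity)).1 hx.1, (lt_div_iff₀ (by positivity)).1 hx.2.1⟩

theorem IsValid.eventually_approx {c : RootCode} (h : c.IsValid) :
    ∀ᶠ b in Filter.atTop, ∃ a, c.Approx a b := by
  have hr := h.isRoot_val
  have hd : aeval c.val (derivative c.neg) < aeval c.val (derivative c.pos) :=
    (aeval_natPolynomial_mono _ hr.pos.le hr.2.1.le).trans_lt
      (h.2.2.trans_le (aeval_natPolynomial_mono _ c.lo_nonneg hr.1.le))
  filter_upwards [eventually_isValid hr.pos hr.2.2 hd hr.1 hr.2.1] with b hb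
  obtain ⟨a, hv, -, hlo, hhi⟩ := hb
  exact ⟨a, hv, (lo_le_lo_iff c (c.1, a, b)).1 hlo, (hi_le_hi_iff c (c.1, a, b)).1 hhi⟩

/-- Intervals of length `2 / (b + 1)` with `b` at least this large decide whether the third number
is the sum or the product of the first two. -/
def precision (c : RootCode × RootCode × RootCode) : ℕ :=
  (8 + 2 * c.1.size + 2 * c.2.1.size) * separationBound c.1.size c.2.1.size c.2.2.size ^
    (c.1.degreeBound * c.2.1.degreeBound * c.2.2.degreeBound)

theorem primrec_precision : Primrec precision := by
  have hsum : Primrec (List.sum : List ℕ → ℕ) :=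
    Primrec.list_foldr (h := fun _ (p : ℕ × ℕ) => p.1 + p.2) Primrec.id (Primrec.const 0)
      (Primrec.nat_add.comp (Primrec.fst.comp Primrec.snd) (Primrec.snd.comp Primrec.snd)).to₂
  have hpow : Primrec₂ fun m n : ℕ => m ^ n := Primrec₂.unpaired'.1 Nat.Primrec.pow
  have hsize : Primrec size := Primrec.succ.comp (Primrec.nat_add.comp
    (hsum.comp (Primrec.fst.comp Primrec.fst)) (hsum.comp (Primrec.snd.comp Primrec.fst)))
  have hdeg : Primrec degreeBound := Primrec.nat_add.comp
    (Primrec.list_length.comp (Primrec.fst.comp Primrec.fst))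
    (Primrec.list_length.comp (Primrec.snd.comp Primrec.fst))
  have i1 : Primrec fun c : RootCode × RootCode × RootCode => c.1 := Primrec.fst
  have i2 : Primrec fun c : RootCode × RootCode × RootCode => c.2.1 :=
    Primrec.fst.comp Primrec.snd
  have i3 : Primrec fun c : RootCode × RootCode × RootCode => c.2.2 :=
    Primrec.snd.comp Primrec.snd
  have add {f g : RootCode × RootCode × RootCode → ℕ} (hf : Primrec f) (hg : Primrec g) :
      Primrec fun c => f c + g c := Primrec.nat_add.comp hf hg
  have mul {f g : RootCode × RootCode × RootCode → ℕ} (hf : Primrec f) (hg : Primrec g) :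
      Primrec fun c => f c * g c := Primrec.nat_mul.comp hf hg
  have s1 := hsize.comp i1
  have s2 := hsize.comp i2
  have s3 := hsize.comp i3
  exact mul (add (add (Primrec.const 8) (mul (Primrec.const 2) s1)) (mul (Primrec.const 2) s2))
    (hpow.comp (mul (mul (mul s1 s2) s3) (add (add (add s1 s2) s3) (mul s1 s2)))
      (mul (mul (hdeg.comp i1) (hdeg.comp i2)) (hdeg.comp i3)))

theorem IsValid.val_le_size {c : RootCode} (h : c.IsValid) : c.val ≤ c.size := by
  obtain ⟨f, -, hf, -, hr, -⟩ := h.isRootWithBounds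
  have := hr _ hf
  rw [Complex.norm_real, Real.norm_eq_abs] at this
  exact (le_abs_self _).trans this

/-- If the sum or product `t` of the first two numbers is closer to the third number than the
precision allows for different numbers, then the two are equal. -/
theorem eq_val_of_abs_sub_lt {c₁ c₂ c₃ : RootCode} (h₁ : c₁.IsValid) (h₂ : c₂.IsValid)
    (h₃ : c₃.IsValid) {t : ℝ} (ht : t = c₁.val + c₂.val ∨ t = c₁.val * c₂.val) {b : ℕ}
    (hb : precision (c₁, c₂, c₃) ≤ b)
    (hlt : |t - c₃.val| * (b + 1) ≤ 8 + 2 * c₁.size + 2 * c₂.size) : t = c₃.val := by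
  by_contra hne
  have key := one_le_norm_mul_separationBound_pow h₁.isRootWithBounds h₂.isRootWithBounds
    h₃.isRootWithBounds (t := (t : ℂ)) (by
      rcases ht with rfl | rfl
      · left; push_cast; rfl
      · right; push_cast; rfl) (by exact_mod_cast hne)
  rw [← Complex.ofReal_sub, Complex.norm_real, Real.norm_eq_abs] at key
  have hb' : ((8 + 2 * c₁.size + 2 * c₂.size) *
      (separationBound c₁.size c₂.size c₃.size : ℝ) ^
        (c₁.degreeBound * c₂.degreeBound * c₃.degreeBound)) ≤ b := by
    exact_mod_cast hb
  set M : ℝ := (separationBound c₁.size c₂.size c₃.size : ℝ) ^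
        (c₁.degreeBound * c₂.degreeBound * c₃.degreeBound)
  have hM : 0 ≤ M := by positivity
  have h : (b + 1 : ℝ) * 1 ≤ (b + 1) * (|t - c₃.val| * M) := by gcongr
  have h' : |t - c₃.val| * (b + 1) * M ≤ (8 + 2 * c₁.size + 2 * c₂.size) * M := by gcongr
  linarith

/-- A numerical certificate, with intervals at the scale `b`, that the third number is the sum of
the first two. -/
theorem val_add_val_eq_iff {c₁ c₂ c₃ : RootCode} (h₁ : c₁.IsValid) (h₂ : c₂.IsValid)
    (h₃ : c₃.IsValid) : c₁.val + c₂.val = c₃.val ↔ ∃ x : (ℕ × ℕ × ℕ) × ℕ,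
      (c₁.Approx x.1.1 x.2 ∧ c₂.Approx x.1.2.1 x.2 ∧ c₃.Approx x.1.2.2 x.2) ∧
      precision (c₁, c₂, c₃) ≤ x.2 ∧
      x.1.1 + x.1.2.1 ≤ x.1.2.2 + 4 ∧ x.1.2.2 ≤ x.1.1 + x.1.2.1 + 4 := by
  constructor
  · intro h
    obtain ⟨b, ⟨⟨⟨a₁, e₁⟩, a₂, e₂⟩, a₃, e₃⟩, hb⟩ := (((h₁.eventually_approx.and
      h₂.eventually_approx).and h₃.eventually_approx).and
        (Filter.eventually_ge_atTop (precision (c₁, c₂, c₃)))).exists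
    obtain ⟨l₁, u₁⟩ := e₁.val_mem h₁
    obtain ⟨l₂, u₂⟩ := e₂.val_mem h₂
    obtain ⟨l₃, u₃⟩ := e₃.val_mem h₃
    rw [← h] at l₃ u₃
    refine ⟨((a₁, a₂, a₃), b), ⟨e₁, e₂, e₃⟩, hb, ?_, ?_⟩
    · suffices (a₁ + a₂ : ℝ) ≤ a₃ + 4 by exact_mod_cast this
      linarith
    · suffices (a₃ : ℝ) ≤ a₁ + a₂ + 4 by exact_mod_cast this
      linarith
  · rintro ⟨⟨⟨a₁, a₂, a₃⟩, b⟩, ⟨e₁, e₂, e₃⟩, hb, n₁, n₂⟩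
    obtain ⟨l₁, u₁⟩ := e₁.val_mem h₁
    obtain ⟨l₂, u₂⟩ := e₂.val_mem h₂
    obtain ⟨l₃, u₃⟩ := e₃.val_mem h₃
    have n₁' : (a₁ + a₂ : ℝ) ≤ a₃ + 4 := by exact_mod_cast n₁
    have n₂' : (a₃ : ℝ) ≤ a₁ + a₂ + 4 := by exact_mod_cast n₂
    refine eq_val_of_abs_sub_lt h₁ h₂ h₃ (Or.inl rfl) hb ?_
    have hb0 : (0 : ℝ) < b + 1 := by positivity
    have hs₁ : (0 : ℝ) ≤ c₁.size := by positivity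
    have hs₂ : (0 : ℝ) ≤ c₂.size := by positivity
    rw [← abs_of_pos hb0, ← abs_mul, abs_le]
    constructor <;> linarith

/-- A numerical certificate, with intervals at the scale `b`, that the third number is the product
of the first two. -/
theorem val_mul_val_eq_iff {c₁ c₂ c₃ : RootCode} (h₁ : c₁.IsValid) (h₂ : c₂.IsValid)
    (h₃ : c₃.IsValid) : c₁.val * c₂.val = c₃.val ↔ ∃ x : (ℕ × ℕ × ℕ) × ℕ,
      (c₁.Approx x.1.1 x.2 ∧ c₂.Approx x.1.2.1 x.2 ∧ c₃.Approx x.1.2.2 x.2) ∧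
      precision (c₁, c₂, c₃) ≤ x.2 ∧
      x.1.1 * x.1.2.1 ≤ (x.1.2.2 + 2) * (x.2 + 1) ∧
      x.1.2.2 * (x.2 + 1) ≤ (x.1.1 + 2) * (x.1.2.1 + 2) := by
  have hp₁ := c₁.val_pos
  have hp₂ := c₂.val_pos
  constructor
  · intro h
    obtain ⟨b, ⟨⟨⟨a₁, e₁⟩, a₂, e₂⟩, a₃, e₃⟩, hb⟩ := (((h₁.eventually_approx.and
      h₂.eventually_approx).and h₃.eventually_approx).and
        (Filter.eventually_ge_atTop (precision (c₁, c₂, c₃)))).exists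
    obtain ⟨l₁, u₁⟩ := e₁.val_mem h₁
    obtain ⟨l₂, u₂⟩ := e₂.val_mem h₂
    obtain ⟨l₃, u₃⟩ := e₃.val_mem h₃
    rw [← h] at l₃ u₃
    have hl := mul_le_mul l₁.le l₂.le (by positivity) (by positivity)
    have hu := mul_le_mul u₁.le u₂.le (by positivity) (by positivity)
    refine ⟨((a₁, a₂, a₃), b), ⟨e₁, e₂, e₃⟩, hb, ?_, ?_⟩
    · suffices (a₁ * a₂ : ℝ) ≤ (a₃ + 2) * (b + 1) by exact_mod_cast this
      have : c₁.val * c₂.val * (b + 1) * (b + 1) ≤ (a₃ + 2) * (b + 1) := by gcongr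
      linarith
    · suffices (a₃ * (b + 1) : ℝ) ≤ (a₁ + 2) * (a₂ + 2) by exact_mod_cast this
      have : (a₃ : ℝ) * (b + 1) ≤ c₁.val * c₂.val * (b + 1) * (b + 1) := by gcongr
      linarith
  · rintro ⟨⟨⟨a₁, a₂, a₃⟩, b⟩, ⟨e₁, e₂, e₃⟩, hb, n₁, n₂⟩
    obtain ⟨l₁, u₁⟩ := e₁.val_mem h₁
    obtain ⟨l₂, u₂⟩ := e₂.val_mem h₂
    obtain ⟨l₃, u₃⟩ := e₃.val_mem h₃
    have n₁' : (a₁ * a₂ : ℝ) ≤ (a₃ + 2) * (b + 1) := by exact_mod_cast n₁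
    have n₂' : (a₃ * (b + 1) : ℝ) ≤ (a₁ + 2) * (a₂ + 2) := by exact_mod_cast n₂
    refine eq_val_of_abs_sub_lt h₁ h₂ h₃ (Or.inr rfl) hb ?_
    have hb0 : (0 : ℝ) < b + 1 := by positivity
    have hl := mul_le_mul l₁.le l₂.le (by positivity) (by positivity)
    have hu := mul_le_mul u₁.le u₂.le (by positivity) (by positivity)
    have hl₃ : (a₃ : ℝ) * (b + 1) ≤ c₃.val * (b + 1) * (b + 1) := by gcongr
    have hu₃ : c₃.val * (b + 1) * (b + 1) ≤ (a₃ + 2) * (b + 1) := by gcongr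
    -- The rounding error `2 * a₁ + 2 * a₂` is at most `(b + 1) * (2 * c₁.size + 2 * c₂.size)`.
    have hs₁ : c₁.val * (b + 1) ≤ c₁.size * (b + 1) := by
      gcongr
      exact h₁.val_le_size
    have hs₂ : c₂.val * (b + 1) ≤ c₂.size * (b + 1) := by
      gcongr
      exact h₂.val_le_size
    refine le_of_mul_le_mul_right ?_ hb0
    have hb1 : (1 : ℝ) ≤ b + 1 := by linarith [(Nat.cast_nonneg b : (0 : ℝ) ≤ b)]
    rw [← abs_of_pos hb0, ← abs_mul, ← abs_mul, abs_of_pos hb0, abs_le]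
    constructor <;> linarith

theorem computable_normalize₃ :
    Computable fun c : RootCode × RootCode × RootCode =>
      (c.1.normalize, c.2.1.normalize, c.2.2.normalize) :=
  (computable_normalize.comp Computable.fst).pair
    ((computable_normalize.comp (Computable.fst.comp Computable.snd)).pair
      (computable_normalize.comp (Computable.snd.comp Computable.snd)))

section Certificates

/-- Three codes together with a certificate: three left ends of intervals and a common scale. -/
abbrev CertifiedTriple := (RootCode × RootCode × RootCode) × (ℕ × ℕ × ℕ) × ℕ

theorem primrecPred_approx₃ : PrimrecPred fun x : CertifiedTriple =>
    x.1.1.Approx x.2.1.1 x.2.2 ∧ x.1.2.1.Approx x.2.1.2.1 x.2.2 ∧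
      x.1.2.2.Approx x.2.1.2.2 x.2.2 := by
  have c : Primrec fun x : CertifiedTriple => x.1 := Primrec.fst
  have a : Primrec fun x : CertifiedTriple => x.2.1 := Primrec.fst.comp Primrec.snd
  have b : Primrec fun x : CertifiedTriple => x.2.2 := Primrec.snd.comp Primrec.snd
  exact (primrecPred_approx (Primrec.fst.comp c) (Primrec.fst.comp a) b).and
    ((primrecPred_approx (Primrec.fst.comp (Primrec.snd.comp c))
      (Primrec.fst.comp (Primrec.snd.comp a)) b).and
    (primrecPred_approx (Primrec.snd.comp (Primrec.snd.comp c))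
      (Primrec.snd.comp (Primrec.snd.comp a)) b))

/-- A relation of three numbers is semidecidable if for valid codes it is equivalent to the existence
of approximations at the required precision that pass a primitive recursive test. -/
theorem semiDec_of_certificate {p : RootCode × RootCode × RootCode → Prop}
    {t : (ℕ × ℕ × ℕ) × ℕ → Prop} (ht : PrimrecPred t)
    (hp : ∀ c : RootCode × RootCode × RootCode, p c ↔
      p (c.1.normalize, c.2.1.normalize, c.2.2.normalize))
    (h : ∀ c₁ c₂ c₃ : RootCode, c₁.IsValid → c₂.IsValid → c₃.IsValid →
      (p (c₁, c₂, c₃) ↔ ∃ x : (ℕ × ℕ × ℕ) × ℕ,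
        (c₁.Approx x.1.1 x.2 ∧ c₂.Approx x.1.2.1 x.2 ∧ c₃.Approx x.1.2.2 x.2) ∧
        precision (c₁, c₂, c₃) ≤ x.2 ∧ t x)) : SemiDec p := by
  have h1 : PrimrecPred fun x : CertifiedTriple =>
      (x.1.1.Approx x.2.1.1 x.2.2 ∧ x.1.2.1.Approx x.2.1.2.1 x.2.2 ∧
        x.1.2.2.Approx x.2.1.2.2 x.2.2) ∧ precision x.1 ≤ x.2.2 ∧ t x.2 :=
    primrecPred_approx₃.and ((Primrec.nat_le.comp (primrec_precision.comp Primrec.fst)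
      (Primrec.snd.comp Primrec.snd)).and (ht.comp Primrec.snd))
  refine ((SemiDec.of_computablePred h1.computablePred).exists_snd.comp
    computable_normalize₃).of_eq fun c => ?_
  rw [hp, h _ _ _ (isValid_normalize _) (isValid_normalize _) (isValid_normalize _)]

end Certificates

theorem semiDec_add : SemiDec fun c : RootCode × RootCode × RootCode =>
    c.1.val + c.2.1.val = c.2.2.val := by
  have a : Primrec fun x : (ℕ × ℕ × ℕ) × ℕ => x.1.1 + x.1.2.1 := Primrec.nat_add.comp
    (Primrec.fst.comp Primrec.fst) (Primrec.fst.comp (Primrec.snd.comp Primrec.fst))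
  have a₃ : Primrec fun x : (ℕ × ℕ × ℕ) × ℕ => x.1.2.2 :=
    Primrec.snd.comp (Primrec.snd.comp Primrec.fst)
  exact semiDec_of_certificate
    ((Primrec.nat_le.comp a (Primrec.nat_add.comp a₃ (Primrec.const 4))).and
      (Primrec.nat_le.comp a₃ (Primrec.nat_add.comp a (Primrec.const 4))))
    (fun c => by simp only [val_normalize]) fun _ _ _ => val_add_val_eq_iff

theorem semiDec_mul : SemiDec fun c : RootCode × RootCode × RootCode =>
    c.1.val * c.2.1.val = c.2.2.val := by
  have a₁ : Primrec fun x : (ℕ × ℕ × ℕ) × ℕ => x.1.1 := Primrec.fst.comp Primrec.fst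
  have a₂ : Primrec fun x : (ℕ × ℕ × ℕ) × ℕ => x.1.2.1 :=
    Primrec.fst.comp (Primrec.snd.comp Primrec.fst)
  have a₃ : Primrec fun x : (ℕ × ℕ × ℕ) × ℕ => x.1.2.2 :=
    Primrec.snd.comp (Primrec.snd.comp Primrec.fst)
  have b : Primrec fun x : (ℕ × ℕ × ℕ) × ℕ => x.2 + 1 := Primrec.succ.comp Primrec.snd
  have two {f : (ℕ × ℕ × ℕ) × ℕ → ℕ} (hf : Primrec f) : Primrec fun x => f x + 2 :=
    Primrec.nat_add.comp hf (Primrec.const 2)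
  exact semiDec_of_certificate
    ((Primrec.nat_le.comp (Primrec.nat_mul.comp a₁ a₂) (Primrec.nat_mul.comp (two a₃) b)).and
      (Primrec.nat_le.comp (Primrec.nat_mul.comp a₃ b) (Primrec.nat_mul.comp (two a₁) (two a₂))))
    (fun c => by simp only [val_normalize]) fun _ _ _ => val_mul_val_eq_iff

theorem isAlgebraic_val (c : RootCode) : IsAlgebraic ℚ c.val := by
  have h := c.isValid_normalize.isRootWithBounds
  obtain ⟨f, hf, hx, -⟩ := h
  rw [val_normalize] at hx
  have h : IsAlgebraic ℤ ((algebraMap ℝ ℂ) c.val) := ⟨f, hf, hx⟩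
  exact ((isAlgebraic_algebraMap_iff (algebraMap ℝ ℂ).injective).1 h).extendScalars
    (algebraMap ℤ ℚ).injective_int

theorem exists_computable_add :
    ∃ f : RootCode × RootCode → RootCode, Computable f ∧ ∀ c, (f c).val = c.1.val + c.2.val := by
  obtain ⟨f, hf, h⟩ := (semiDec_add.comp
    (g := fun x : (RootCode × RootCode) × RootCode => (x.1.1, x.1.2, x.2))
    ((Computable.fst.comp Computable.fst).pair
      ((Computable.snd.comp Computable.fst).pair Computable.snd))).exists_computable fun c => by
    obtain ⟨d, hd⟩ := exists_val_eq (add_pos c.1.val_pos c.2.val_pos)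
      (c.1.isAlgebraic_val.add c.2.isAlgebraic_val)
    exact ⟨d, hd.symm⟩
  exact ⟨f, hf, fun c => (h c).symm⟩

theorem exists_computable_mul :
    ∃ f : RootCode × RootCode → RootCode, Computable f ∧ ∀ c, (f c).val = c.1.val * c.2.val := by
  obtain ⟨f, hf, h⟩ := (semiDec_mul.comp
    (g := fun x : (RootCode × RootCode) × RootCode => (x.1.1, x.1.2, x.2))
    ((Computable.fst.comp Computable.fst).pair
      ((Computable.snd.comp Computable.fst).pair Computable.snd))).exists_computable fun c => by
    obtain ⟨d, hd⟩ := exists_val_eq (mul_pos c.1.val_pos c.2.val_pos)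
      (c.1.isAlgebraic_val.mul c.2.isAlgebraic_val)
    exact ⟨d, hd.symm⟩
  exact ⟨f, hf, fun c => (h c).symm⟩

theorem semiDec_val_eq : SemiDec fun c : RootCode × RootCode => c.1.val = c.2.val :=
  (semiDec_mul.comp (g := fun c : RootCode × RootCode => (c.1, one, c.2))
    (Computable.fst.pair ((Computable.const one).pair Computable.snd))).of_eq fun c => by
      simp only [val_one, mul_one]

end RootCode

/-! ### The algebraic closure of the rational numbers -/

namespace RootCode

/-- The complex number `(x₁ - x₂) + (x₃ - x₄) i` for four codes of positive reals `x₁, …, x₄`. -/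
noncomputable def complexVal (c : (RootCode × RootCode) × RootCode × RootCode) : ℂ :=
  ⟨c.1.1.val - c.1.2.val, c.2.1.val - c.2.2.val⟩

theorem complexVal_eq (c : (RootCode × RootCode) × RootCode × RootCode) :
    complexVal c = ((c.1.1.val : ℂ) - c.1.2.val) + (c.2.1.val - c.2.2.val) * Complex.I := by
  apply Complex.ext <;> simp [complexVal]

theorem isAlgebraic_I : IsAlgebraic ℚ Complex.I :=
  ⟨X ^ 2 + 1, (monic_X_pow_add_C (1 : ℚ) two_ne_zero).ne_zero, by simp⟩

theorem isAlgebraic_complexVal (c : (RootCode × RootCode) × RootCode × RootCode) :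
    IsAlgebraic ℚ (complexVal c) := by
  have h (d : RootCode) : IsAlgebraic ℚ (d.val : ℂ) :=
    (isAlgebraic_algebraMap_iff (algebraMap ℝ ℂ).injective).2 d.isAlgebraic_val
  rw [complexVal_eq]
  exact ((h _).sub (h _)).add (((h _).sub (h _)).mul isAlgebraic_I)

theorem exists_val_sub_val_eq {x : ℝ} (hx : IsAlgebraic ℚ x) :
    ∃ c d : RootCode, c.val - d.val = x := by
  obtain ⟨n, hn⟩ := exists_nat_gt (|x|)
  have hn0 : (0 : ℝ) < n := (abs_nonneg x).trans_lt hn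
  have hnalg : IsAlgebraic ℚ (n : ℝ) := isAlgebraic_natCast n
  obtain ⟨c, hc⟩ := exists_val_eq (x := x + n) (by linarith [neg_abs_le x]) (hx.add hnalg)
  obtain ⟨d, hd⟩ := exists_val_eq hn0 hnalg
  exact ⟨c, d, by rw [hc, hd]; ring⟩

theorem exists_complexVal_eq {z : ℂ} (hz : IsAlgebraic ℚ z) : ∃ c, complexVal c = z := by
  have hconj : IsAlgebraic ℚ ((starRingEnd ℂ) z) :=
    hz.algHom ((Complex.conjAe : ℂ →ₐ[ℝ] ℂ).restrictScalars ℚ)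
  have h2 : IsAlgebraic ℚ (2 : ℂ)⁻¹ := by
    have : IsAlgebraic ℚ ((2 : ℕ) : ℂ) := isAlgebraic_natCast 2
    exact_mod_cast this.inv
  have hre : IsAlgebraic ℚ z.re := by
    rw [← isAlgebraic_algebraMap_iff (algebraMap ℝ ℂ).injective, Complex.coe_algebraMap,
      Complex.re_eq_add_conj, div_eq_mul_inv]
    exact (hz.add hconj).mul h2
  have him : IsAlgebraic ℚ z.im := by
    rw [← isAlgebraic_algebraMap_iff (algebraMap ℝ ℂ).injective, Complex.coe_algebraMap,
      Complex.im_eq_sub_conj, div_eq_mul_inv, mul_inv]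
    exact (hz.sub hconj).mul (h2.mul isAlgebraic_I.inv)
  obtain ⟨c₁, c₂, h⟩ := exists_val_sub_val_eq hre
  obtain ⟨c₃, c₄, h'⟩ := exists_val_sub_val_eq him
  exact ⟨((c₁, c₂), c₃, c₄), Complex.ext h h'⟩

theorem exists_numbering_algebraicClosure :
    ∃ N : EffectiveNumbering (algebraicClosure ℚ ℂ) ((RootCode × RootCode) × RootCode × RootCode),
      ∀ c, (N.val c : ℂ) = complexVal c := by
  obtain ⟨add, hadd, val_add⟩ := exists_computable_add
  obtain ⟨mul, hmul, val_mul⟩ := exists_computable_mul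
  let T := (RootCode × RootCode) × RootCode × RootCode
  have A {f g : T × T → RootCode} (hf : Computable f) (hg : Computable g) :
      Computable fun x => add (f x, g x) := hadd.comp (hf.pair hg)
  have M {f g : T × T → RootCode} (hf : Computable f) (hg : Computable g) :
      Computable fun x => mul (f x, g x) := hmul.comp (hf.pair hg)
  have a₁ : Computable fun x : T × T => x.1.1.1 :=
    Computable.fst.comp (Computable.fst.comp Computable.fst)
  have a₂ : Computable fun x : T × T => x.1.1.2 :=
    Computable.snd.comp (Computable.fst.comp Computable.fst)
  have a₃ : Computable fun x : T × T => x.1.2.1 :=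
    Computable.fst.comp (Computable.snd.comp Computable.fst)
  have a₄ : Computable fun x : T × T => x.1.2.2 :=
    Computable.snd.comp (Computable.snd.comp Computable.fst)
  have b₁ : Computable fun x : T × T => x.2.1.1 :=
    Computable.fst.comp (Computable.fst.comp Computable.snd)
  have b₂ : Computable fun x : T × T => x.2.1.2 :=
    Computable.snd.comp (Computable.fst.comp Computable.snd)
  have b₃ : Computable fun x : T × T => x.2.2.1 :=
    Computable.fst.comp (Computable.snd.comp Computable.snd)
  have b₄ : Computable fun x : T × T => x.2.2.2 :=
    Computable.snd.comp (Computable.snd.comp Computable.snd)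
  refine ⟨{
    val := fun c => ⟨complexVal c, mem_algebraicClosure_iff.2 (isAlgebraic_complexVal c)⟩
    surjective := fun z => ?_
    add := fun a b => ((add (a.1.1, b.1.1), add (a.1.2, b.1.2)),
      add (a.2.1, b.2.1), add (a.2.2, b.2.2))
    mul := fun a b =>
      ((add (add (mul (a.1.1, b.1.1), mul (a.1.2, b.1.2)),
          add (mul (a.2.1, b.2.2), mul (a.2.2, b.2.1))),
        add (add (mul (a.1.1, b.1.2), mul (a.1.2, b.1.1)),
          add (mul (a.2.1, b.2.1), mul (a.2.2, b.2.2)))),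
        add (add (mul (a.1.1, b.2.1), mul (a.1.2, b.2.2)),
          add (mul (a.2.1, b.1.1), mul (a.2.2, b.1.2))),
        add (add (mul (a.1.1, b.2.2), mul (a.1.2, b.2.1)),
          add (mul (a.2.1, b.1.2), mul (a.2.2, b.1.1))))
    computable_add := ((A a₁ b₁).pair (A a₂ b₂)).pair ((A a₃ b₃).pair (A a₄ b₄))
    computable_mul :=
      ((A (A (M a₁ b₁) (M a₂ b₂)) (A (M a₃ b₄) (M a₄ b₃))).pair
        (A (A (M a₁ b₂) (M a₂ b₁)) (A (M a₃ b₃) (M a₄ b₄)))).pair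
      ((A (A (M a₁ b₃) (M a₂ b₄)) (A (M a₃ b₁) (M a₄ b₂))).pair
        (A (A (M a₁ b₄) (M a₂ b₃)) (A (M a₃ b₂) (M a₄ b₁))))
    val_add := fun a b => Subtype.ext (Complex.ext ?_ ?_)
    val_mul := fun a b => Subtype.ext (Complex.ext ?_ ?_)
    semiDec_eq := ((semiDec_val_eq.comp ((A a₁ b₂).pair (A b₁ a₂))).and
      (semiDec_val_eq.comp ((A a₃ b₄).pair (A b₃ a₄)))).of_eq ?_ }, fun _ => rfl⟩
  · obtain ⟨c, hc⟩ := exists_complexVal_eq (mem_algebraicClosure_iff.1 z.2)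
    exact ⟨c, Subtype.ext hc⟩
  · simp [complexVal, val_add]
    ring
  · simp [complexVal, val_add]
    ring
  · simp [complexVal, val_add, val_mul]
    ring
  · simp [complexVal, val_add, val_mul]
    ring
  · rintro ⟨a, b⟩
    simp only [val_add, Subtype.mk.injEq, Complex.ext_iff, complexVal]
    constructor
    · rintro ⟨h, h'⟩
      constructor <;> linarith
    · rintro ⟨h, h'⟩
      constructor <;> linarith

/-- The code of the positive `p`-th root of `2`, as the root of `X ^ p - 2` between `1` and `2`. -/
def rootTwo (p : ℕ) : RootCode := ((List.replicate p 0 ++ [1], [2]), 2, 1)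

theorem computable_rootTwo : Computable rootTwo := by
  have h : Primrec fun p : ℕ => List.replicate p 0 ++ [1] := by
    refine (Primrec.nat_rec' (g := fun _ => [1]) (h := fun _ q => 0 :: q.2) Primrec.id
      (Primrec.const [1]) (Primrec.list_cons.comp (Primrec.const 0)
        (Primrec.snd.comp Primrec.snd)).to₂ : Primrec fun p : ℕ => _).of_eq fun p => ?_
    induction p with
    | zero => rfl
    | succ p ih => simpa [List.replicate_succ] using ih
  exact ((h.pair (Primrec.const [2])).pair (Primrec.const (2, 1))).to_comp

theorem natPoly_replicate_append (p : ℕ) : natPoly (List.replicate p 0 ++ [1]) = X ^ p := by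
  induction p with
  | zero => simp [natPoly]
  | succ p ih =>
    have : natPoly (List.replicate (p + 1) 0 ++ [1]) =
      C 0 + X * natPoly (List.replicate p 0 ++ [1]) := rfl
    rw [this, ih, C_0, zero_add, pow_succ']

theorem val_rootTwo {p : ℕ} (hp : 2 ≤ p) : (rootTwo p).val = (2 : ℝ) ^ (1 / (p : ℝ)) := by
  have hpos : (rootTwo p).pos = X ^ p := natPoly_replicate_append p
  have hneg : (rootTwo p).neg = C 2 := by simp [RootCode.neg, rootTwo, natPoly]
  have hlo : (rootTwo p).lo = 1 := by norm_num [lo, rootTwo]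
  have hhi : (rootTwo p).hi = 2 := by norm_num [hi, rootTwo]
  have hp1 : (1 : ℝ) < p := by exact_mod_cast hp
  have hv : (rootTwo p).IsValid := by
    unfold IsValid
    rw [hpos, hneg, hlo, hhi]
    refine ⟨by rw [map_pow, aeval_X, aeval_C, one_pow]; norm_num, ?_, ?_⟩
    · simp only [aeval_C, map_pow, aeval_X]
      calc ((algebraMap ℕ ℝ) 2) = 2 ^ 1 := by simp
        _ < 2 ^ p := pow_lt_pow_right₀ (by norm_num) (by omega)
    · simp only [derivative_C, derivative_X_pow, map_zero, map_mul, map_pow, aeval_X]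
      simp
      linarith
  refine hv.val_eq ⟨?_, ?_, ?_⟩
  · rw [hlo]
    exact Real.one_lt_rpow (by norm_num) (by positivity)
  · rw [hhi]
    calc (2 : ℝ) ^ (1 / (p : ℝ)) < 2 ^ (1 : ℝ) :=
          Real.rpow_lt_rpow_of_exponent_lt (by norm_num) (by
            rw [div_lt_one (by positivity)]
            exact hp1)
      _ = 2 := Real.rpow_one 2
  · rw [hpos, hneg, map_pow, aeval_X, aeval_C, one_div,
      Real.rpow_inv_natCast_pow (by norm_num) (by omega)]
    simp

end RootCode

/-! ### The halting problem and the odd primes -/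

theorem semiDec_jumpOfEmpty : SemiDec fun n => n ∈ jumpOfEmpty := by
  have hc : Computable fun x : ℕ × ℕ => Nat.Partrec.Code.evaln x.2
      (Denumerable.ofNat Nat.Partrec.Code x.1) x.1 :=
    Nat.Partrec.Code.primrec_evaln.to_comp.comp
      ((Computable.snd.pair ((Computable.ofNat _).comp Computable.fst)).pair Computable.fst)
  refine ⟨fun n k => (Nat.Partrec.Code.evaln k (Denumerable.ofNat Nat.Partrec.Code n) n).isSome,
    Primrec.option_isSome.to_comp.comp hc, fun n => ?_⟩
  simp only [jumpOfEmpty, Set.mem_ofPred_eq, Part.dom_iff_mem, Nat.Partrec.Code.evaln_complete,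
    Option.isSome_iff_exists, Option.mem_def]
  exact exists_comm

theorem jumpOfEmpty_nonempty : jumpOfEmpty.Nonempty :=
  ⟨Encodable.encode Nat.Partrec.Code.zero, by
    simp only [jumpOfEmpty, Set.mem_ofPred_eq, Denumerable.ofNat_encode]
    trivial⟩

theorem exists_computable_range_eq_jumpOfEmpty :
    ∃ g : ℕ → ℕ, Computable g ∧ Set.range g = jumpOfEmpty := by
  obtain ⟨f, hf, h⟩ := semiDec_jumpOfEmpty
  obtain ⟨m, hm⟩ := jumpOfEmpty_nonempty
  refine ⟨fun k => bif f k.unpair.1 k.unpair.2 then k.unpair.1 else m,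
    Computable.cond (hf.comp (Computable.fst.comp Computable.unpair)
      (Computable.snd.comp Computable.unpair)) (Computable.fst.comp Computable.unpair)
      (Computable.const m), Set.eq_of_subset_of_subset ?_ ?_⟩
  · rintro _ ⟨k, rfl⟩
    cases hk : f k.unpair.1 k.unpair.2 with
    | false => simpa [hk] using hm
    | true => simpa [hk] using (h _).2 ⟨_, hk⟩
  · intro n hn
    obtain ⟨k, hk⟩ := (h n).1 hn
    exact ⟨Nat.pair n k, by simp [hk]⟩

/-- The diagonal halting problem is undecidable: it decides the halting of any program `c` on input
`0`, through the program that ignores its input and runs `c` on `0`. -/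
theorem not_computablePred_jumpOfEmpty : ¬ ComputablePred fun n => n ∈ jumpOfEmpty := by
  intro h
  refine ComputablePred.halting_problem 0 ?_
  let g : Nat.Partrec.Code → ℕ := fun c =>
    Encodable.encode (Nat.Partrec.Code.comp c (Nat.Partrec.Code.const 0))
  have hg : Computable g := Computable.encode.comp
    (Nat.Partrec.Code.primrec₂_comp.to_comp.comp Computable.id (Computable.const _))
  obtain ⟨f, hf, hfe⟩ := ComputablePred.computable_iff.1 h
  refine ComputablePred.computable_iff.2 ⟨fun c => f (g c), hf.comp hg, ?_⟩
  funext c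
  rw [← congrFun hfe (g c)]
  simp only [jumpOfEmpty, Set.mem_ofPred_eq, g, Denumerable.ofNat_encode, Nat.Partrec.Code.eval,
    Nat.Partrec.Code.eval_const]
  exact congrArg Part.Dom (Part.bind_some 0 c.eval).symm

theorem infinite_odd_primes : {p : ℕ | p.Prime ∧ 2 < p}.Infinite := by
  refine Set.infinite_of_not_bddAbove fun ⟨b, hb⟩ => ?_
  obtain ⟨p, hp, hpp⟩ := Nat.exists_infinite_primes (b + 3)
  have := hb (show p ∈ {p : ℕ | p.Prime ∧ 2 < p} from ⟨hpp, by omega⟩)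
  omega

theorem prime_oddPrime (n : ℕ) : (oddPrime n).Prime :=
  (Nat.nth_mem_of_infinite infinite_odd_primes n).1

theorem two_lt_oddPrime (n : ℕ) : 2 < oddPrime n :=
  (Nat.nth_mem_of_infinite infinite_odd_primes n).2

theorem oddPrime_injective : Function.Injective oddPrime :=
  Nat.nth_injective infinite_odd_primes

theorem primrecPred_prime : PrimrecPred Nat.Prime := by
  have h1 : PrimrecRel fun m p : ℕ => ¬ (2 ≤ m ∧ p % m = 0) :=
    ((Primrec.nat_le.comp (Primrec.const 2) Primrec.fst).and
      (Primrec.eq.comp (Primrec.nat_mod.comp Primrec.snd Primrec.fst) (Primrec.const 0))).not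
  have h2 : PrimrecPred fun p : ℕ => 2 ≤ p ∧ ∀ m < p, ¬ (2 ≤ m ∧ p % m = 0) :=
    (Primrec.nat_le.comp (Primrec.const 2) Primrec.id).and
      (h1.forall_lt.comp Primrec.id Primrec.id)
  refine h2.of_eq fun p => ?_
  rw [Nat.prime_def_lt']
  refine and_congr_right fun _ => ⟨fun h m hm hmp hd => h m hmp ⟨hm, Nat.mod_eq_zero_of_dvd hd⟩,
    fun h m hmp hm => h m hm.1 hmp (Nat.dvd_of_mod_eq_zero hm.2)⟩

theorem computable_oddPrime : Computable oddPrime := by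
  classical
  have hex : ∀ n : ℕ, ∃ m, n < m ∧ m.Prime ∧ 2 < m := fun n => by
    obtain ⟨m, hm, hp⟩ := Nat.exists_infinite_primes (n + 3)
    exact ⟨m, by omega, hp, by omega⟩
  have hnext : Computable fun n => Nat.find (hex n) :=
    Computable.find (P := fun n m => n < m ∧ m.Prime ∧ 2 < m)
      ((Primrec.nat_lt.comp Primrec.fst Primrec.snd).and
        ((primrecPred_prime.comp Primrec.snd).and
          (Primrec.nat_lt.comp (Primrec.const 2) Primrec.snd))).computablePred hex
  refine (Computable.nat_rec (f := id) (g := fun _ => oddPrime 0)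
    (h := fun _ q => Nat.find (hex q.2)) Computable.id (Computable.const _)
    (hnext.comp (Computable.snd.comp Computable.snd)).to₂).of_eq fun n => ?_
  induction n with
  | zero => rfl
  | succ n ih =>
    change Nat.find (hex (Nat.rec (oddPrime 0) (fun _ q => Nat.find (hex q)) n)) = _
    have ih' : (Nat.rec (oddPrime 0) (fun _ q => Nat.find (hex q)) n : ℕ) = oddPrime n := ih
    rw [ih']
    have hmono := Nat.nth_strictMono infinite_odd_primes
    refine le_antisymm (Nat.find_min' _ ⟨hmono n.lt_succ_self, prime_oddPrime _,
      two_lt_oddPrime _⟩) ?_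
    obtain ⟨h1, h2⟩ := Nat.find_spec (hex (oddPrime n))
    set m := Nat.find (hex (oddPrime n))
    rw [← Nat.nth_count (p := fun p : ℕ => p.Prime ∧ 2 < p) h2] at h1 ⊢
    exact hmono.monotone (hmono.lt_iff_lt.1 h1)

open IntermediateField

/-! ### The field generated by the roots of two -/

theorem rootOfTwo_pow (n : ℕ) : rootOfTwo n ^ oddPrime n = 2 := by
  rw [rootOfTwo, one_div, Real.rpow_inv_natCast_pow (by norm_num) (prime_oddPrime n).ne_zero]

theorem odd_oddPrime (n : ℕ) : Odd (oddPrime n) :=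
  (prime_oddPrime n).odd_of_ne_two (two_lt_oddPrime n).ne'

theorem eq_rootOfTwo {n : ℕ} {x : ℝ} (hx : x ^ oddPrime n = 2) : x = rootOfTwo n :=
  (odd_oddPrime n).strictMono_pow.injective (hx.trans (rootOfTwo_pow n).symm)

theorem rootOfTwo_ne_intCast (n : ℕ) (y : ℤ) : rootOfTwo n ≠ y := by
  intro h
  have hy : y ^ oddPrime n = 2 := by
    have := rootOfTwo_pow n
    rw [h] at this
    exact_mod_cast this
  have h2 : (2 : ℤ) ∣ y := Int.prime_two.dvd_of_dvd_pow hy.symm.dvd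
  have h4 : (2 : ℤ) ^ 2 ∣ 2 := by
    calc (2 : ℤ) ^ 2 ∣ 2 ^ oddPrime n := pow_dvd_pow 2 (two_lt_oddPrime n).le
      _ ∣ y ^ oddPrime n := pow_dvd_pow_of_dvd h2 _
      _ = 2 := hy
  exact absurd h4 (by norm_num)

theorem pow_oddPrime_ne_two (n : ℕ) (b : ℚ) : b ^ oddPrime n ≠ 2 := by
  intro h
  have hirr := irrational_nrt_of_notint_nrt (oddPrime n) 2 (by exact_mod_cast rootOfTwo_pow n)
    (fun ⟨y, hy⟩ => rootOfTwo_ne_intCast n y hy) (prime_oddPrime n).pos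
  have hb : (b : ℝ) ^ oddPrime n = 2 := by exact_mod_cast h
  exact hirr ⟨b, eq_rootOfTwo hb⟩

theorem minpoly_rootOfTwo {K : Type*} [Field K] [Algebra K ℝ] {n : ℕ}
    (h : ∀ b : K, b ^ oddPrime n ≠ 2) : minpoly K (rootOfTwo n) = X ^ oddPrime n - C 2 :=
  (minpoly.eq_of_irreducible_of_monic (X_pow_sub_C_irreducible_of_prime (prime_oddPrime n) h)
    (by rw [map_sub, map_pow, aeval_X, aeval_C, rootOfTwo_pow, map_ofNat, sub_self])
    (monic_X_pow_sub_C 2 (prime_oddPrime n).ne_zero)).symm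

theorem isIntegral_rootOfTwo (K : Type*) [Field K] [Algebra K ℝ] (n : ℕ) :
    IsIntegral K (rootOfTwo n) :=
  ⟨X ^ oddPrime n - C 2, monic_X_pow_sub_C 2 (prime_oddPrime n).ne_zero, by
    rw [eval₂_sub, eval₂_X_pow, eval₂_C, rootOfTwo_pow, map_ofNat, sub_self]⟩

theorem finrank_adjoin_rootOfTwo {K : Type*} [Field K] [Algebra K ℝ] {n : ℕ}
    (h : ∀ b : K, b ^ oddPrime n ≠ 2) : Module.finrank K K⟮rootOfTwo n⟯ = oddPrime n := by
  rw [adjoin.finrank (isIntegral_rootOfTwo K n), minpoly_rootOfTwo h, natDegree_X_pow_sub_C]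

/-- Adjoining one more root multiplies the degree by `oddPrime i` or, when the root is already
there, by `1`; so the degree stays prime to the other odd primes. -/
theorem coprime_finrank_adjoin_rootOfTwo (S : Finset ℕ) {n : ℕ} (hn : n ∉ S) :
    FiniteDimensional ℚ (adjoin ℚ (rootOfTwo '' S)) ∧
      (Module.finrank ℚ (adjoin ℚ (rootOfTwo '' S))).Coprime (oddPrime n) := by
  classical
  induction S using Finset.induction_on with
  | empty =>
    have h : adjoin ℚ (rootOfTwo '' ((∅ : Finset ℕ) : Set ℕ)) = ⊥ := by simp
    rw [h]
    exact ⟨inferInstance, by simp⟩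
  | insert i S hi ih =>
    obtain ⟨hfin, hcop⟩ := ih fun h => hn (Finset.mem_insert_of_mem h)
    have hne : i ≠ n := fun h => hn (h ▸ Finset.mem_insert_self i S)
    rw [Finset.coe_insert, Set.image_insert_eq, Set.insert_eq, Set.union_comm]
    set L := adjoin ℚ (rootOfTwo '' (S : Set ℕ)) with hL
    rw [← adjoin_adjoin_left, ← hL]
    have hfinL : FiniteDimensional L L⟮rootOfTwo i⟯ :=
      adjoin.finiteDimensional (isIntegral_rootOfTwo L i)
    have hmul := Module.finrank_mul_finrank ℚ L L⟮rootOfTwo i⟯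
    refine ⟨(FiniteDimensional.trans ℚ L L⟮rootOfTwo i⟯ :), ?_⟩
    change (Module.finrank ℚ L⟮rootOfTwo i⟯).Coprime _
    rw [← hmul]
    refine hcop.mul_left ?_
    by_cases h : ∃ b : L, b ^ oddPrime i = 2
    · obtain ⟨b, hb⟩ := h
      have hbr : (b : ℝ) = rootOfTwo i := eq_rootOfTwo (by exact_mod_cast congrArg (L.val) hb)
      have : L⟮rootOfTwo i⟯ = ⊥ := adjoin_simple_eq_bot_iff.2 (mem_bot.2 ⟨b, hbr⟩)
      rw [this, IntermediateField.finrank_bot]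
      exact Nat.coprime_one_left _
    · rw [finrank_adjoin_rootOfTwo (not_exists.1 h)]
      exact (Nat.coprime_primes (prime_oddPrime i) (prime_oddPrime n)).2
        (oddPrime_injective.ne hne)

theorem rootOfTwo_mem_jumpRootField_iff (n : ℕ) :
    rootOfTwo n ∈ jumpRootField ↔ n ∈ jumpOfEmpty := by
  classical
  refine ⟨fun h => ?_, fun h => subset_adjoin ℚ _ (Set.mem_image_of_mem _ h)⟩
  by_contra hn
  obtain ⟨T, hT, hx⟩ := exists_finset_of_mem_adjoin h
  obtain ⟨S, hS, rfl⟩ := Finset.subset_set_image_iff.1 hT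
  obtain ⟨hfin, hcop⟩ := coprime_finrank_adjoin_rootOfTwo S fun h => hn (hS h)
  rw [Finset.coe_image] at hx
  have hdvd := finrank_dvd_of_le_right (adjoin_simple_le_iff.2 hx)
  rw [finrank_adjoin_rootOfTwo (pow_oddPrime_ne_two n)] at hdvd
  exact (prime_oddPrime n).one_lt.ne'
    ((Nat.coprime_self _).1 (hcop.coprime_dvd_left hdvd))

theorem exists_pow_eq_two_iff (n : ℕ) :
    (∃ b : jumpRootField, b ^ oddPrime n = 2) ↔ n ∈ jumpOfEmpty := by
  rw [← rootOfTwo_mem_jumpRootField_iff]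
  constructor
  · rintro ⟨b, hb⟩
    rw [← eq_rootOfTwo (by exact_mod_cast congrArg jumpRootField.val hb)]
    exact b.2
  · intro h
    exact ⟨⟨_, h⟩, Subtype.ext (rootOfTwo_pow n)⟩

/-- The generator of the field with the given number, for numbers in the jump. -/
noncomputable def jumpRoot {n : ℕ} (h : n ∈ jumpOfEmpty) : jumpRootField :=
  ⟨rootOfTwo n, (rootOfTwo_mem_jumpRootField_iff n).2 h⟩

theorem closure_range_jumpRoot {g : ℕ → ℕ} (hg : Set.range g = jumpOfEmpty) :
    Subfield.closure (Set.range fun k => jumpRoot (hg ▸ Set.mem_range_self k : g k ∈ jumpOfEmpty))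
      = ⊤ := by
  set s := Set.range fun k => jumpRoot (hg ▸ Set.mem_range_self k : g k ∈ jumpOfEmpty)
  have hle : jumpRootField.toSubfield ≤ (Subfield.closure s).map (algebraMap jumpRootField ℝ) := by
    refine adjoin_le_subfield ℚ _ ?_ ?_
    · rintro _ ⟨q, rfl⟩
      exact ⟨(q : jumpRootField), SubfieldClass.ratCast_mem (Subfield.closure s) q,
        map_ratCast (algebraMap _ ℝ) q⟩
    · rintro _ ⟨n, hn, rfl⟩
      obtain ⟨k, rfl⟩ : n ∈ Set.range g := hg ▸ hn
      exact ⟨_, Subfield.subset_closure (Set.mem_range_self k), rfl⟩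
  refine eq_top_iff.2 fun x _ => ?_
  obtain ⟨y, hy, hyx⟩ := hle x.2
  rwa [← Subtype.ext hyx]

theorem isAlgebraic_jumpRootField : Algebra.IsAlgebraic ℚ jumpRootField :=
  isAlgebraic_adjoin fun _ ⟨n, _, h⟩ => h ▸ isIntegral_rootOfTwo ℚ n

/-- An automorphism permutes the roots of `X ^ oddPrime n - 2` in the field, and there is only one
such root because the field is real. -/
theorem isRigidField_jumpRootField : IsRigidField jumpRootField := by
  intro σ
  obtain ⟨g, -, hg⟩ := exists_computable_range_eq_jumpOfEmpty
  have h : (σ : jumpRootField →+* jumpRootField) = RingHom.id _ := by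
    refine RingHom.eq_of_eqOn_of_field_closure_eq_top (closure_range_jumpRoot hg) ?_
    rintro _ ⟨k, rfl⟩
    refine Subtype.ext (eq_rootOfTwo ?_)
    have h2 : jumpRoot (hg ▸ Set.mem_range_self k : g k ∈ jumpOfEmpty) ^ oddPrime (g k) = 2 :=
      Subtype.ext (rootOfTwo_pow (g k))
    have h3 := congrArg σ h2
    rw [map_pow, map_ofNat] at h3
    exact congrArg Subtype.val h3
  exact RingEquiv.ext fun x => RingHom.congr_fun h x

theorem not_normal_jumpRootField : ¬ Normal ℚ jumpRootField := by
  intro hnormal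
  obtain ⟨n, hn⟩ := jumpOfEmpty_nonempty
  have hmin : minpoly ℚ (jumpRoot hn) = X ^ oddPrime n - C 2 := by
    rw [← minpoly_rootOfTwo (pow_oddPrime_ne_two n)]
    exact (minpoly.algebraMap_eq (algebraMap jumpRootField ℝ).injective (jumpRoot hn)).symm
  have hsplit := hnormal.splits (jumpRoot hn)
  rw [hmin] at hsplit
  have hsep : (X ^ oddPrime n - C 2 : ℚ[X]).Separable :=
    (X_pow_sub_C_irreducible_of_prime (prime_oddPrime n) (pow_oddPrime_ne_two n)).separable
  set f : jumpRootField[X] := (X ^ oddPrime n - C 2 : ℚ[X]).map (algebraMap ℚ jumpRootField)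
    with hf
  have hcard : Multiset.card f.roots = oddPrime n := by
    rw [← hsplit.natDegree_eq_card_roots, hf, natDegree_map, natDegree_X_pow_sub_C]
  have hall : ∀ x ∈ f.roots, x = jumpRoot hn := by
    intro x hx
    have hx := (mem_roots'.1 hx).2
    simp only [hf, IsRoot.def, Polynomial.map_sub, Polynomial.map_pow, map_X, map_C, eval_sub,
      eval_pow, eval_X, eval_C, sub_eq_zero] at hx
    refine Subtype.ext (eq_rootOfTwo ?_)
    rw [map_ofNat] at hx
    exact congrArg Subtype.val hx
  have hle := Multiset.nodup_iff_count_le_one.1 (nodup_roots (hsep.map (f := algebraMap ℚ _)))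
    (jumpRoot hn)
  rw [Multiset.eq_replicate_card.2 hall, Multiset.count_replicate_self, hcard] at hle
  have := two_lt_oddPrime n
  omega

theorem isReduciblePoly_iff (n : ℕ) :
    IsReduciblePoly (X ^ oddPrime n - C 2 : jumpRootField[X]) ↔ n ∈ jumpOfEmpty := by
  rw [← exists_pow_eq_two_iff]
  have hp := two_lt_oddPrime n
  constructor
  · rintro ⟨g, h, hg, hh, heq⟩
    by_contra hne
    rcases (X_pow_sub_C_irreducible_of_prime (prime_oddPrime n)
      (not_exists.1 hne)).isUnit_or_isUnit heq with hu | hu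
    · exact hg.ne' (natDegree_eq_zero_of_isUnit hu)
    · exact hh.ne' (natDegree_eq_zero_of_isUnit hu)
  · rintro ⟨b, hb⟩
    obtain ⟨q, hq⟩ := dvd_iff_isRoot.2
      (show IsRoot (X ^ oddPrime n - C 2 : jumpRootField[X]) b by simp [hb])
    have hmonic : (X ^ oddPrime n - C 2 : jumpRootField[X]).Monic :=
      monic_X_pow_sub_C 2 (prime_oddPrime n).ne_zero
    have hdeg := congrArg natDegree hq
    have hq0 : q ≠ 0 := by
      rintro rfl
      exact hmonic.ne_zero (by rw [hq, mul_zero])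
    rw [natDegree_X_pow_sub_C, natDegree_mul (X_sub_C_ne_zero b) hq0, natDegree_X_sub_C] at hdeg
    exact ⟨X - C b, q, by simp, by omega, hq⟩

theorem polyOfCoeffs_X_pow_sub_two {K : Type*} [Field K] (m : ℕ) :
    polyOfCoeffs ((-2 : K) :: (List.replicate m 0 ++ [1])) = X ^ (m + 1) - C 2 := by
  have h : polyOfCoeffs (List.replicate m 0 ++ [1] : List K) = X ^ m := by
    induction m with
    | zero => simp [polyOfCoeffs]
    | succ m ih =>
      have : polyOfCoeffs (List.replicate (m + 1) 0 ++ [1] : List K) =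
        C 0 + X * polyOfCoeffs (List.replicate m 0 ++ [1]) := rfl
      rw [this, ih, C_0, zero_add, pow_succ']
  have h' : polyOfCoeffs ((-2 : K) :: (List.replicate m 0 ++ [1])) =
    C (-2) + X * polyOfCoeffs (List.replicate m 0 ++ [1]) := rfl
  rw [h', h, C_neg, pow_succ']
  ring

/-- A splitting algorithm would decide the halting problem by way of the polynomials
`X ^ oddPrime n - 2`. -/
theorem not_hasSplittingAlgorithm (P : ComputablePresentation jumpRootField) :
    ¬ P.HasSplittingAlgorithm := by
  intro h
  refine not_computablePred_jumpOfEmpty ?_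
  let l : ℕ → List ℕ := fun m => P.code (-2) :: (List.replicate m (P.code 0) ++ [P.code 1])
  have hl : Computable l := by
    have hrep : Primrec fun m : ℕ => List.replicate m (P.code 0) ++ [P.code 1] := by
      refine (Primrec.nat_rec' (g := fun _ => [P.code 1]) (h := fun _ q => P.code 0 :: q.2)
        Primrec.id (Primrec.const _) (Primrec.list_cons.comp (Primrec.const _)
          (Primrec.snd.comp Primrec.snd)).to₂ : Primrec fun m : ℕ => _).of_eq fun m => ?_
      induction m with
      | zero => rfl
      | succ m ih => simpa [List.replicate_succ] using ih
    exact (Primrec.list_cons.comp (Primrec.const _) hrep).to_comp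
  obtain ⟨f, hf, hfe⟩ := ComputablePred.computable_iff.1 h
  refine ComputablePred.computable_iff.2 ⟨fun n => f (l (oddPrime n - 1)),
    hf.comp (hl.comp (Computable.pred.comp computable_oddPrime)), ?_⟩
  funext n
  rw [← congrFun hfe (l (oddPrime n - 1)), ← isReduciblePoly_iff]
  have hmap : l (oddPrime n - 1) = (((-2 : jumpRootField) ::
      (List.replicate (oddPrime n - 1) 0 ++ [1])).map P.code) := by simp [l]
  have hpoly : polyOfCoeffs ((-2 : jumpRootField) ::
      (List.replicate (oddPrime n - 1) 0 ++ [1])) = X ^ oddPrime n - C 2 := by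
    rw [polyOfCoeffs_X_pow_sub_two, Nat.sub_add_cancel (prime_oddPrime n).one_le]
  refine propext ⟨fun hred => ⟨_, hmap, hpoly ▸ hred⟩, ?_⟩
  rintro ⟨c, hc, hred⟩
  rw [hmap] at hc
  rwa [← List.map_injective_iff.2 P.code_injective hc, hpoly] at hred

theorem exists_rabinEmbedding :
    ∃ (P : ComputablePresentation jumpRootField)
      (Q : ComputablePresentation (algebraicClosure ℚ ℂ))
      (i : jumpRootField →+* algebraicClosure ℚ ℂ), P.IsRabinEmbedding Q i := by
  have halg := isAlgebraic_jumpRootField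
  obtain ⟨N, hN⟩ := RootCode.exists_numbering_algebraicClosure
  obtain ⟨g, hg, hrange⟩ := exists_computable_range_eq_jumpOfEmpty
  let i : jumpRootField →+* algebraicClosure ℚ ℂ :=
    ((algebraMap ℝ ℂ).comp (algebraMap jumpRootField ℝ)).codRestrict (algebraicClosure ℚ ℂ)
      fun x => mem_algebraicClosure_iff.2 <|
        ((halg.isAlgebraic x).algebraMap).algebraMap
  obtain ⟨add, hadd, val_add⟩ := RootCode.exists_computable_add
  have hroot : Computable fun k => RootCode.rootTwo (oddPrime (g k)) :=
    RootCode.computable_rootTwo.comp (computable_oddPrime.comp hg)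
  -- The codes stand for positive numbers, so the root `r` is written as `(r + 1) - 1`.
  obtain ⟨M, G, hG, hval⟩ := N.exists_numbering_of_closure_eq_top i (closure_range_jumpRoot hrange)
    (r := fun k => ((add (RootCode.rootTwo (oddPrime (g k)), RootCode.one), RootCode.one),
      RootCode.one, RootCode.one))
    (((hadd.comp (hroot.pair (Computable.const _))).pair (Computable.const _)).pair
      (Computable.const _))
    fun k => by
      refine Subtype.ext ?_
      rw [hN, RootCode.complexVal_eq]
      simp only [val_add, RootCode.val_rootTwo (two_lt_oddPrime (g k)).le]
      push_cast
      simp only [add_sub_cancel_right, sub_self, zero_mul, add_zero]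
      rfl
  obtain ⟨P, _, d, -, hd, -, hPd⟩ := M.exists_presentation
  obtain ⟨Q, c, _, hc, -, hQc, -⟩ := N.exists_presentation
  refine ⟨P, Q, i, (algebraicClosure.isAlgClosure ℚ ℂ).isAlgClosed,
    ⟨fun k => c (G (d k)), hc.comp (hG.comp hd), fun x => ?_⟩, fun y => ?_⟩
  · change c (G (d (P.code x))) = _
    rw [hQc, hval, hPd]
  · obtain ⟨p, hp, hy⟩ := (algebraicClosure.isAlgebraic ℚ ℂ).isAlgebraic y
    refine ⟨p.map (algebraMap ℚ jumpRootField), Polynomial.map_ne_zero hp, ?_⟩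
    rw [eval₂_map, Subsingleton.elim (i.comp (algebraMap ℚ jumpRootField)) (algebraMap ℚ _)]
    exact hy

theorem automorphismsExtendAlong (P : ComputablePresentation jumpRootField) {E : Type*} [Field E]
    (Q : ComputablePresentation E) (i : jumpRootField →+* E) : P.AutomorphismsExtendAlong Q i :=
  fun α _ => ⟨RingEquiv.refl E, ⟨id, Computable.id, fun _ => rfl⟩, fun x => by
    rw [isRigidField_jumpRootField α]
    rfl⟩

theorem proposition4p2 :
    CharZero jumpRootField ∧
    Algebra.IsAlgebraic ℚ jumpRootField ∧
    ¬ Normal ℚ jumpRootField ∧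
    IsRigidField jumpRootField ∧
    (∃ P : ComputablePresentation jumpRootField, P.ComputableExtendabilityOfAutomorphisms) ∧
    (∀ P : ComputablePresentation jumpRootField, ¬ P.HasSplittingAlgorithm) ∧
    (∀ (P : ComputablePresentation jumpRootField) (E : Type) (_ : Field E)
      (Q : ComputablePresentation E) (i : jumpRootField →+* E),
        P.IsRabinEmbedding Q i → P.AutomorphismsExtendAlong Q i) := by
  obtain ⟨P, Q, i, hi⟩ := exists_rabinEmbedding
  exact ⟨inferInstance, isAlgebraic_jumpRootField, not_normal_jumpRootField,
    isRigidField_jumpRootField,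
    ⟨P, fun α hα => ⟨_, _, Q, i, hi, automorphismsExtendAlong P Q i α hα⟩⟩,
    not_hasSplittingAlgorithm, fun P _ _ Q i _ => automorphismsExtendAlong P Q i⟩
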